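/- All Hilbert spaces are finite dimensional and $\log=\log_2$. For a density matrix $\rho_{AR}$ let $H_{\min}(\rho_{AR}|R)=\sup_{\sigma_R}(-\log\lambda(\sigma_R))$, where $\sigma_R$ ranges over all density matrices on $R$ and $\lambda(\sigma_R)$ is the minimal real $\lambda$ such that $\lambda\,\mathrm{id}_A\otimes\sigma_R-\rho_{AR}\ge 0$ (those $\sigma_R$ for which no such $\lambda$ exists are disregarded). Let $|\Phi_K\rangle=K^{-1/2}\sum_{i=1}^K|i\rangle|i\rangle$, and $\|X\|_1=\mathrm{tr}\sqrt{X^\dagger X}$. For a unit vector $|\psi\rangle_{ABR}$ and integers $K,L\ge 1$, a state merging protocol of $|\psi\rangle_{ABR}$ with error $\delta$ and entanglement cost $\log K-\log L$ is a process $\mathcal M: AA_0\otimes BB_0\to A_1\otimes B_1B'B$ consisting of local operations and classical communication between Alice ($AA_0\to A_1$) and Bob ($BB_0\to B_1B'B$), where $\dim A_0=\dim B_0=K$, $\dim A_1=\dim B_1=L$ and $B'\cong A$, such that $$\big\|(\mathcal M\otimes\mathrm{id}_R)\big(|\Phi_K\rangle\langle\Phi_K|_{A_0B_0}\otimes|\psi\rangle\langle\psi|_{ABR}\big)-|\Phi_L\rangle\langle\Phi_L|_{A_1B_1}\otimes|\psi\rangle\langle\psi|_{B'BR}\big\|_1\le\delta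 .$$ Statement. Let $|\psi\rangle_{ABR}$ be a unit vector with reduced density matrix $\rho_{AR}=\mathrm{tr}_B|\psi\rangle\langle\psi|$, let $\varepsilon>0$, and put $c=-H_{\min}(\rho_{AR}|R)+2\log(1/\varepsilon)$. (1) For every $\eta>0$ there are integers $K,L\ge1$ with $c\le\log K-\log L<c+\eta$. (2) For all integers $K,L\ge 1$ with $\log K-\log L\ge c$ there is a state merging protocol of $|\psi\rangle_{ABR}$ with error $2\sqrt{2\varepsilon}$ and entanglement cost $\log K-\log L$. It can be chosen of the following form: Alice performs a measurement with operators $P_j:AA_0\to A_1$, $\sum_jP_j^\dagger P_j=\mathrm{id}$, and tells Bob the outcome $j$; Bob then applies a quantum operation $BB_0\to B_1B'B$ that depends on $j$. (3) Suppose moreover that $\dim(A)\,K=NL$ with $N\in\mathbb N$, and let $Q_1,\dots,Q_N:AA_0\to A_1$ be any fixed operators with $Q_jQ_k^\dagger=\delta_{jk}\,\mathrm{id}_{A_1}$ (projections onto $N$ mutually orthogonal $L$-dimensional subspaces, each followed by a unitary onto $A_1$). Then the measurement can be taken to be $P_j=Q_jU$ with a Haar-random unitary $U$ on $AA_0$: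 for every unitary $U$ the $Q_jU$ form a measurement, and there is a function $\delta$, integrable with respect to the Haar probability measure on the unitary group of $AA_0$, with $\int\delta(U)\,dU\le2\sqrt{2\varepsilon}$, such that for every $U$ Alice's measurement $(Q_jU)_j$, followed by suitable quantum operations of Bob that depend on $j$ and $U$, is a state merging protocol of $|\psi\rangle_{ABR}$ with error $\delta(U)$ and entanglement cost $\log K-\log L$. -/

import Mathlib

namespace StateMerging

open MeasureTheory
open scoped Kronecker ComplexOrder MatrixOrder

/-! Finite-dimensional systems are given by finite index types (orthonormal bases), operators by
complex matrices, and the tensor product of systems by the product of the index types. -/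

/-- The rank-one operator `|v⟩⟨v|`. -/
def pureState {n : Type} (v : n → ℂ) : Matrix n n ℂ := Matrix.vecMulVec v (star v)

/-- Density matrices: nonnegative operators of trace one. -/
def IsDensity {n : Type} [Fintype n] (ρ : Matrix n n ℂ) : Prop :=
  ρ.PosSemidef ∧ ρ.trace = 1

/-- The trace norm `tr √(X† X)`. -/
noncomputable def traceNorm {n : Type} [Fintype n] [DecidableEq n] (X : Matrix n n ℂ) : ℝ :=
  (CFC.sqrt (X.conjTranspose * X)).trace.re

/-- The partial trace over `B` of an operator on `A ⊗ B ⊗ R`. -/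
def partialTraceB {A B R : Type} [Fintype B] (ρ : Matrix ((A × B) × R) ((A × B) × R) ℂ) :
    Matrix (A × R) (A × R) ℂ :=
  Matrix.of fun p q => ∑ b, ρ ((p.1, b), p.2) ((q.1, b), q.2)

/-- `lam` is the minimum real number such that `lam • (id_A ⊗ σ_R) - ρ_AR` is nonnegative, that is,
`H_min(ρ_AR|σ_R) = - log₂ lam`. -/
def IsMinLambda {A R : Type} [Fintype A] [Fintype R] [DecidableEq A]
    (ρ : Matrix (A × R) (A × R) ℂ) (σ : Matrix R R ℂ) (lam : ℝ) : Prop :=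
  IsLeast {l : ℝ | (((l : ℂ) • ((1 : Matrix A A ℂ) ⊗ₖ σ)) - ρ).PosSemidef} lam

/-- The conditional min-entropy `H_min(ρ_AR|R) = sup_σ H_min(ρ_AR|σ_R)`, over all density matrices
`σ_R`. The `σ_R` for which no `lam` as above exists (where `H_min(ρ_AR|σ_R) = -∞`) do not
contribute; the maximally mixed `σ_R` always does. -/
noncomputable def condMinEntropy {A R : Type} [Fintype A] [Fintype R] [DecidableEq A]
    (ρ : Matrix (A × R) (A × R) ℂ) : ℝ :=
  sSup {h : ℝ | ∃ (σ : Matrix R R ℂ) (lam : ℝ),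
    IsDensity σ ∧ IsMinLambda ρ σ lam ∧ h = -Real.logb 2 lam}

/-- The map `ρ ↦ M ρ M†`. -/
def conjMap {m n : Type} [Fintype n] (M : Matrix m n ℂ) : Matrix n n ℂ →ₗ[ℂ] Matrix m m ℂ where
  toFun ρ := M * ρ * M.conjTranspose
  map_add' ρ σ := by rw [Matrix.mul_add, Matrix.add_mul]
  map_smul' c ρ := by simp

/-- A quantum measurement: finitely many operators with `∑ x, M x† M x = id`. The same condition
says that the `M x` are the Kraus operators of a quantum operation. -/
def IsMeasurement {m n : Type} [Fintype m] [Fintype n] [DecidableEq n] {k : ℕ}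
    (M : Fin k → Matrix m n ℂ) : Prop :=
  ∑ x, (M x).conjTranspose * M x = 1

/-- Processes from Alice ⊗ Bob = `a ⊗ b` to `c ⊗ d` by local operations and classical communication.
Either nothing (more) is done, or one of the parties performs a local measurement and tells the
other one the outcome `x`, and they continue with an LOCC process that may depend on `x`. (Unread
outcomes, local quantum operations and local ancillas are included, since the operators of a
measurement may change the local space.) -/
inductive IsLOCC {c d : Type} :
    ∀ {a b : Type}, (Matrix (a × b) (a × b) ℂ →ₗ[ℂ] Matrix (c × d) (c × d) ℂ) → Prop
  | done : IsLOCC (a := c) (b := d) LinearMap.id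
  | alice {a a' b : Type} [Fintype a] [DecidableEq a] [Fintype a'] [Fintype b] [DecidableEq b]
      {k : ℕ} (M : Fin k → Matrix a' a ℂ) (hM : IsMeasurement M)
      (Ψ : Fin k → (Matrix (a' × b) (a' × b) ℂ →ₗ[ℂ] Matrix (c × d) (c × d) ℂ))
      (hΨ : ∀ x, IsLOCC (Ψ x)) :
      IsLOCC (∑ x, (Ψ x).comp (conjMap (M x ⊗ₖ (1 : Matrix b b ℂ))))
  | bob {a b b' : Type} [Fintype a] [DecidableEq a] [Fintype b] [DecidableEq b] [Fintype b']
      {k : ℕ} (M : Fin k → Matrix b' b ℂ) (hM : IsMeasurement M)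
      (Ψ : Fin k → (Matrix (a × b') (a × b') ℂ →ₗ[ℂ] Matrix (c × d) (c × d) ℂ))
      (hΨ : ∀ x, IsLOCC (Ψ x)) :
      IsLOCC (∑ x, (Ψ x).comp (conjMap ((1 : Matrix a a ℂ) ⊗ₖ M x)))

/-- `Λ ⊗ id_R`. -/
def tensorId {x y : Type} (R : Type) (Λ : Matrix x x ℂ →ₗ[ℂ] Matrix y y ℂ)
    (ρ : Matrix (x × R) (x × R) ℂ) : Matrix (y × R) (y × R) ℂ :=
  Matrix.of fun p q => Λ (Matrix.of fun i j => ρ (i, p.2) (j, q.2)) p.1 q.1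

/-- The maximally entangled vector `|Φ_K⟩ = K^(-1/2) ∑ i, |i⟩|i⟩` of Schmidt rank `K`. -/
noncomputable def maxEntangled (K : ℕ) (i j : Fin K) : ℂ :=
  if i = j then ((1 / Real.sqrt K : ℝ) : ℂ) else 0

/-- `|ψ⟩_ABR ⊗ |Φ_K⟩_{A₀B₀}`, with Alice holding `A A₀` and Bob holding `B B₀`. -/
noncomputable def initialVec {A B R : Type} (ψ : (A × B) × R → ℂ) (K : ℕ) :
    ((A × Fin K) × (B × Fin K)) × R → ℂ :=
  fun p => ψ ((p.1.1.1, p.1.2.1), p.2) * maxEntangled K p.1.1.2 p.1.2.2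

/-- `|Φ_L⟩_{A₁B₁} ⊗ |ψ⟩_{B'BR}`, with Alice holding `A₁` and Bob holding `B₁ B' B`, where `B'` is a
copy of `A`. -/
noncomputable def targetVec {A B R : Type} (ψ : (A × B) × R → ℂ) (L : ℕ) :
    (Fin L × (Fin L × A × B)) × R → ℂ :=
  fun p => maxEntangled L p.1.1 p.1.2.1 * ψ (p.1.2.2, p.2)

/-- `M : AA₀ ⊗ BB₀ → A₁ ⊗ B₁B'B` is state merging of `|ψ⟩_ABR` with error `ε`, with `|Φ_K⟩` consumed
and `|Φ_L⟩` produced. Its entanglement cost is `log₂ K - log₂ L`. -/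
def IsStateMerging {A B R : Type} [Fintype A] [Fintype B] [Fintype R]
    [DecidableEq A] [DecidableEq B] [DecidableEq R]
    (ψ : (A × B) × R → ℂ) (K L : ℕ) (ε : ℝ)
    (M : Matrix ((A × Fin K) × (B × Fin K)) ((A × Fin K) × (B × Fin K)) ℂ →ₗ[ℂ]
      Matrix (Fin L × (Fin L × A × B)) (Fin L × (Fin L × A × B)) ℂ) : Prop :=
  IsLOCC M ∧
    traceNorm (tensorId R M (pureState (initialVec ψ K)) - pureState (targetVec ψ L)) ≤ ε

/-- The one-way process in which Alice measures with operators `P j`, tells Bob the outcome `j`, and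
Bob then applies the quantum operation with Kraus operators `D j i`. -/
noncomputable def oneWay {a b c d : Type} [Fintype a] [Fintype b] {N m : ℕ}
    (P : Fin N → Matrix c a ℂ) (D : Fin N → Fin m → Matrix d b ℂ) :
    Matrix (a × b) (a × b) ℂ →ₗ[ℂ] Matrix (c × d) (c × d) ℂ :=
  ∑ j, ∑ i, conjMap (P j ⊗ₖ D j i)

/-! The Haar probability measure on the unitary group. -/

instance compactSpace_unitaryGroup (n : Type) [Fintype n] [DecidableEq n] :
    CompactSpace (Matrix.unitaryGroup n ℂ) := by
  have hK : IsCompact (Set.pi Set.univ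
      (fun _ : n => Set.pi Set.univ (fun _ : n => Metric.closedBall (0 : ℂ) 1))) :=
    isCompact_univ_pi fun _ => isCompact_univ_pi fun _ => isCompact_closedBall 0 1
  have hc : IsClosed {U : Matrix n n ℂ | U.conjTranspose * U = 1} :=
    isClosed_eq (by fun_prop) continuous_const
  have hEq : (Matrix.unitaryGroup n ℂ : Set (Matrix n n ℂ)) =
      {U : Matrix n n ℂ | U.conjTranspose * U = 1} := by
    ext U
    exact Matrix.mem_unitaryGroup_iff'
  refine isCompact_iff_compactSpace.mp (IsCompact.of_isClosed_subset hK ?_ ?_)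
  · rw [hEq]
    exact hc
  · intro U hU i _ j _
    simpa using entry_norm_bound_of_unitary hU i j

noncomputable instance measurableSpace_unitaryGroup (n : Type) [Fintype n] [DecidableEq n] :
    MeasurableSpace (Matrix.unitaryGroup n ℂ) := borel _

instance borelSpace_unitaryGroup (n : Type) [Fintype n] [DecidableEq n] :
    BorelSpace (Matrix.unitaryGroup n ℂ) := ⟨rfl⟩

noncomputable def haarUnitary (n : Type) [Fintype n] [DecidableEq n] :
    Measure (Matrix.unitaryGroup n ℂ) :=
  Measure.haarMeasure ⊤

end StateMerging

namespace StateMerging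

open MeasureTheory
open scoped Kronecker ComplexOrder MatrixOrder

/-! Bob purifies whatever Alice and the reference hold, so Alice only has to decouple: after her
measurement, `A₁` should be nearly maximally mixed and uncorrelated with `R`. The target `|Φ_L⟩ ⊗
|ψ⟩` has exactly such a reduced operator, `id/L ⊗ ρ_R`, and vectors with close reduced operators are
close up to an operation on the purifying side. `exists_contraction` makes this quantitative: polar
decompositions turn the best overlap into `tr √ρ √τ`, which the Powers–Størmer inequality bounds
below. In `exists_oneWay_of_decoupled` each branch `j` deviates from `q j` times the target by at
most `e j`, where trace distance is tested against Hermitian contractions. The total squared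
fidelity `F` then satisfies `1 - F ≤ ∑ e j`, and the trace norm error is at most `2 √(∑ e j)`.

Decoupling comes from a Haar random unitary on `A A₀`, of dimension `n = |A| K`. Let `σ` be
invertible with `ρ ≤ λ id ⊗ σ`, and put `H = σ^(-1/4) ρ σ^(-1/4)`. The second moments of a random
rank-`L` projection (`exists_moment_projection`) bound the mean squared Hilbert–Schmidt deviation of
`H` by `(L/n)² tr H²`. A weighted Cauchy–Schwarz inequality (`re_trace_mul_weighted_le`) returns to
the trace norm at the price of a factor `√L`, and `tr H² ≤ λ` by `re_trace_sq_le`. Consuming `Φ_K`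
replaces `λ` by `λ/K`. The weights `L/n` of the outcomes add up to one, so Jensen gives mean total
deviation at most `√(L λ / K)`.

With `λ ≤ 4 · 2^(-H_min)` the cost condition makes this at most `2ε`, whence the error `2√(2ε)`. The
factor 4 is the room left by the 2 under the root; it pays for a `σ` that is only nearly optimal and
for making it invertible.

If `L` does not divide `n`, overlapping cyclic windows weighted by `1/L` replace the orthogonal
projections. If `L > n`, the cost condition forces `2ε ≥ 1` and any protocol is good enough. The
costs in part (1) come from the density of the rationals. -/

/-! ### Trace norm, and distance from a pure state in terms of fidelity -/

/-- A Hermitian matrix `X` has a sign: a Hermitian contraction `C` with `C X = |X|`. -/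
theorem exists_sign {n : Type} [Fintype n] [DecidableEq n] {X : Matrix n n ℂ}
    (hX : X.IsHermitian) :
    ∃ C : Matrix n n ℂ, C.IsHermitian ∧ (1 - C * C).PosSemidef ∧ C * X = X * C ∧
      (C * X + X).PosSemidef ∧ (C * X - X).PosSemidef ∧ traceNorm X = (C * X).trace.re := by
  have hXs : IsSelfAdjoint X := hX
  have hc : ∀ f : ℝ → ℝ, ContinuousOn f (spectrum ℝ X) := fun f =>
    (Matrix.finite_real_spectrum).continuousOn f
  let sg : ℝ → ℝ := fun x => if 0 ≤ x then 1 else -1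
  have hmul : ∀ f g : ℝ → ℝ, cfc f X * cfc g X = cfc (fun x => f x * g x) X := fun f g =>
    (cfc_mul f g X (hc f) (hc g)).symm
  have hX1 : cfc (fun x : ℝ => x) X = X := cfc_id' ℝ X
  have h1 : cfc (fun _ : ℝ => (1 : ℝ)) X = 1 := cfc_const_one ℝ X
  have hCX : cfc sg X * X = cfc (fun x => sg x * x) X := by
    conv_lhs => rw [← hX1, hX1]
    conv_lhs => rw [show cfc sg X * X = cfc sg X * cfc (fun x : ℝ => x) X by rw [hX1]]
    exact hmul _ _
  have hXC : X * cfc sg X = cfc (fun x => sg x * x) X := by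
    conv_lhs => rw [show X * cfc sg X = cfc (fun x : ℝ => x) X * cfc sg X by rw [hX1]]
    rw [hmul]
    congr 1
    ext x
    ring
  have habs : ∀ x : ℝ, sg x * x = |x| := by
    intro x
    simp only [sg]
    split_ifs with h
    · rw [abs_of_nonneg h, one_mul]
    · rw [abs_of_neg (not_le.mp h)]; ring
  have hsq : ∀ x : ℝ, sg x * sg x = 1 := by
    intro x
    simp only [sg]
    split_ifs <;> norm_num
  have hCXa : cfc sg X * X = cfc (fun x : ℝ => |x|) X := by
    rw [hCX]; congr 1; ext x; exact habs x
  refine ⟨cfc sg X, ?_, ?_, ?_, ?_, ?_, ?_⟩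
  · exact cfc_predicate sg X
  · rw [hmul]
    have : (fun x => sg x * sg x) = fun _ : ℝ => (1 : ℝ) := by ext x; exact hsq x
    rw [this, h1, sub_self]
    exact Matrix.PosSemidef.zero
  · rw [hCX, hXC]
  · rw [← Matrix.nonneg_iff_posSemidef, hCXa]
    have : cfc (fun x : ℝ => |x|) X + X = cfc (fun x : ℝ => |x| + x) X := by
      rw [cfc_add (a := X) _ _ (hc _) (hc _), hX1]
    rw [this]
    exact cfc_nonneg fun x _ => by linarith [neg_abs_le x]
  · rw [← Matrix.nonneg_iff_posSemidef, hCXa]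
    have : cfc (fun x : ℝ => |x|) X - X = cfc (fun x : ℝ => |x| - x) X := by
      rw [cfc_sub (a := X) _ _ (hc _) (hc _), hX1]
    rw [this]
    exact cfc_nonneg fun x _ => by linarith [le_abs_self x]
  · have hnn : 0 ≤ cfc (fun x : ℝ => |x|) X := cfc_nonneg fun x _ => abs_nonneg x
    have hs : cfc (fun x : ℝ => |x|) X * cfc (fun x : ℝ => |x|) X = X.conjTranspose * X := by
      rw [hmul, hX.eq]
      conv_rhs => rw [show X * X = cfc (fun x : ℝ => x) X * cfc (fun x : ℝ => x) X by rw [hX1]]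
      rw [hmul]
      congr 1
      ext x
      exact abs_mul_abs_self x
    rw [traceNorm, hCXa, CFC.sqrt_unique hs hnn]

/-- The squared norm of a vector. -/
noncomputable def normSqVec {n : Type} [Fintype n] (v : n → ℂ) : ℝ := ∑ i, ‖v i‖ ^ 2

theorem normSqVec_nonneg {n : Type} [Fintype n] (v : n → ℂ) : 0 ≤ normSqVec v :=
  Finset.sum_nonneg fun _ _ => by positivity

theorem dotProduct_star_self {n : Type} [Fintype n] (v : n → ℂ) :
    star v ⬝ᵥ v = (normSqVec v : ℂ) := by
  simp [dotProduct, normSqVec, Complex.conj_mul']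

theorem re_dotProduct_star_self {n : Type} [Fintype n] (v : n → ℂ) :
    (star v ⬝ᵥ v).re = normSqVec v := by
  rw [dotProduct_star_self, Complex.ofReal_re]

theorem norm_dotProduct_star_le {n : Type} [Fintype n] (u v : n → ℂ) :
    ‖star u ⬝ᵥ v‖ ≤ √(normSqVec u) * √(normSqVec v) := by
  refine (norm_sum_le _ _).trans ?_
  simp only [Pi.star_apply, norm_mul, norm_star]
  exact Real.sum_mul_le_sqrt_mul_sqrt _ _ _

theorem normSqVec_mulVec_le {m n : Type} [Fintype m] [Fintype n] [DecidableEq n]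
    {C : Matrix m n ℂ} (hC : (1 - C.conjTranspose * C).PosSemidef) (v : n → ℂ) :
    normSqVec (C.mulVec v) ≤ normSqVec v := by
  have h := hC.dotProduct_mulVec_nonneg v
  rw [Matrix.sub_mulVec, dotProduct_sub, Matrix.one_mulVec, ← Matrix.mulVec_mulVec,
    Matrix.dotProduct_mulVec, Matrix.vecMul_conjTranspose, star_star, dotProduct_star_self,
    dotProduct_star_self, ← Complex.ofReal_sub, Complex.zero_le_real] at h
  linarith

theorem trace_mul_pureState {n : Type} [Fintype n] (C : Matrix n n ℂ) (v : n → ℂ) :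
    (C * pureState v).trace = star v ⬝ᵥ C.mulVec v := by
  rw [pureState, Matrix.trace_mul_comm, Matrix.vecMulVec_mul, Matrix.trace_vecMulVec,
    dotProduct_comm, Matrix.dotProduct_mulVec]

theorem pureState_isHermitian {n : Type} (v : n → ℂ) : (pureState v).IsHermitian := by
  ext i j
  simp [pureState, Matrix.vecMulVec_apply, mul_comm]

theorem normSqVec_add_sub {n : Type} [Fintype n] (u v : n → ℂ) :
    normSqVec (u + v) = normSqVec u + normSqVec v + 2 * (star u ⬝ᵥ v).re ∧
    normSqVec (u - v) = normSqVec u + normSqVec v - 2 * (star u ⬝ᵥ v).re := by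
  have h1 : (star v ⬝ᵥ u).re = (star u ⬝ᵥ v).re := by
    rw [← Complex.conj_re, ← Complex.star_def, Matrix.star_dotProduct, star_star]
  constructor
  · rw [← re_dotProduct_star_self, ← re_dotProduct_star_self u, ← re_dotProduct_star_self v]
    simp only [star_add, add_dotProduct, dotProduct_add, Complex.add_re, h1]
    ring
  · rw [← re_dotProduct_star_self, ← re_dotProduct_star_self u, ← re_dotProduct_star_self v]
    simp only [star_sub, sub_dotProduct, dotProduct_sub, Complex.sub_re, h1]
    ring

/-- Rescale `t` to a vector `s` of the same norm as `v`, with the phase that makes `⟨s, v⟩`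
nonnegative. The difference of expectations is then `Re ⟨v - s, C (v + s)⟩`, and Cauchy–Schwarz
applies. This is the contribution of one pure component to the trace distance from `t`. -/
theorem re_expectation_sub_le {n : Type} [Fintype n] [DecidableEq n] {C : Matrix n n ℂ}
    (hC : C.IsHermitian) (hC1 : (1 - C * C).PosSemidef) (v t : n → ℂ) (ht : normSqVec t = 1) :
    (star v ⬝ᵥ C.mulVec v).re - normSqVec v * (star t ⬝ᵥ C.mulVec t).re ≤
      2 * (√(normSqVec v) * √(normSqVec v - ‖star t ⬝ᵥ v‖ ^ 2)) := by
  set p := normSqVec v with hp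
  have hp0 : 0 ≤ p := normSqVec_nonneg v
  set w := star t ⬝ᵥ v with hw
  have hCC : (1 - C.conjTranspose * C).PosSemidef := by rwa [hC.eq]
  obtain ⟨z, hz, hzw⟩ : ∃ z : ℂ, ‖z‖ = 1 ∧ star z * w = ‖w‖ := by
    by_cases h0 : w = 0
    · exact ⟨1, by simp, by simp [h0]⟩
    · have hn : (‖w‖ : ℂ) ≠ 0 := by simpa using h0
      refine ⟨w / ‖w‖, by simp [h0], ?_⟩
      simp only [star_div₀, Complex.star_def, Complex.conj_ofReal]
      rw [div_mul_eq_mul_div, Complex.conj_mul', div_eq_iff hn]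
      ring
  set s : n → ℂ := ((√p : ℂ) * z) • t with hs
  have hsv : star s ⬝ᵥ v = ((√p * ‖w‖ : ℝ) : ℂ) := by
    rw [hs, star_smul, smul_dotProduct, ← hw, smul_eq_mul, star_mul', mul_assoc, hzw]
    simp
  have hns : normSqVec s = p := by
    have : normSqVec s = p * normSqVec t := by
      simp only [normSqVec, hs, Pi.smul_apply, smul_eq_mul, norm_mul, hz, mul_pow, Finset.mul_sum]
      refine Finset.sum_congr rfl fun i _ => ?_
      rw [Complex.norm_real, Real.norm_of_nonneg (Real.sqrt_nonneg _), Real.sq_sqrt hp0]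
      ring
    rw [this, ht, mul_one]
  have hss : (star s ⬝ᵥ C.mulVec s) = p * (star t ⬝ᵥ C.mulVec t) := by
    rw [hs, star_smul, smul_dotProduct, Matrix.mulVec_smul, dotProduct_smul, smul_smul, smul_eq_mul,
      Complex.star_def, Complex.conj_mul', norm_mul, hz, Complex.norm_real,
      Real.norm_of_nonneg (Real.sqrt_nonneg _), mul_one, ← Complex.ofReal_pow, Real.sq_sqrt hp0]
  have hcross : (star v ⬝ᵥ C.mulVec s).re = (star s ⬝ᵥ C.mulVec v).re := by
    rw [← Complex.conj_re, ← Complex.star_def, Matrix.star_dotProduct, star_star,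
      Matrix.star_mulVec, hC.eq, Matrix.dotProduct_mulVec]
  have key : (star v ⬝ᵥ C.mulVec v).re - p * (star t ⬝ᵥ C.mulVec t).re =
      (star (v - s) ⬝ᵥ C.mulVec (v + s)).re := by
    have := congrArg Complex.re hss
    rw [Complex.re_ofReal_mul] at this
    rw [star_sub, Matrix.mulVec_add, sub_dotProduct, dotProduct_add, dotProduct_add]
    simp only [Complex.add_re, Complex.sub_re]
    linarith
  rw [key]
  refine (Complex.re_le_norm _).trans ((norm_dotProduct_star_le _ _).trans ?_)
  have h1 := normSqVec_mulVec_le hCC (v + s)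
  have hvs : (star v ⬝ᵥ s).re = √p * ‖w‖ := by
    have : (star v ⬝ᵥ s) = star (star s ⬝ᵥ v) := by
      rw [Matrix.star_dotProduct]
    rw [this, hsv]; simp
  have h2 := (normSqVec_add_sub v s).1
  have h3 := (normSqVec_add_sub v s).2
  rw [hns, hvs, ← hp] at h2 h3
  calc √(normSqVec (v - s)) * √(normSqVec (C.mulVec (v + s)))
      ≤ √(normSqVec (v - s)) * √(normSqVec (v + s)) := by gcongr
    -- The two squared norms are `2p ∓ 2 √p ‖w‖`.
    _ = √(4 * (p * (p - ‖w‖ ^ 2))) := by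
        rw [← Real.sqrt_mul (normSqVec_nonneg _), h2, h3]
        congr 1
        have := Real.sq_sqrt hp0
        linear_combination -4 * ‖w‖ ^ 2 * this
    _ = 2 * (√p * √(p - ‖w‖ ^ 2)) := by
        rw [Real.sqrt_mul (by norm_num), Real.sqrt_mul hp0]
        congr 1
        rw [show (4 : ℝ) = 2 ^ 2 by norm_num, Real.sqrt_sq (by norm_num)]

/-- The trace distance of a mixture of pure states from a pure state, in terms of the fidelity. -/
theorem traceNorm_sum_pureState_sub_le {n κ : Type} [Fintype n] [DecidableEq n] [Fintype κ]
    (v : κ → n → ℂ) (t : n → ℂ) (ht : normSqVec t = 1) (hv : ∑ k, normSqVec (v k) = 1) :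
    traceNorm (∑ k, pureState (v k) - pureState t) ≤ 2 * √(1 - ∑ k, ‖star t ⬝ᵥ v k‖ ^ 2) := by
  have hH : (∑ k, pureState (v k) - pureState t).IsHermitian := by
    refine Matrix.IsHermitian.sub ?_ (pureState_isHermitian t)
    rw [Matrix.IsHermitian, Matrix.conjTranspose_sum]
    exact Finset.sum_congr rfl fun k _ => pureState_isHermitian _
  obtain ⟨C, hC, hC1, -, -, -, htr⟩ := exists_sign hH
  have hle : ∀ k, ‖star t ⬝ᵥ v k‖ ^ 2 ≤ normSqVec (v k) := by
    intro k
    have h := norm_dotProduct_star_le t (v k)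
    rw [ht, Real.sqrt_one, one_mul] at h
    calc ‖star t ⬝ᵥ v k‖ ^ 2 ≤ √(normSqVec (v k)) ^ 2 := by gcongr
      _ = _ := Real.sq_sqrt (normSqVec_nonneg _)
  rw [htr, Matrix.mul_sub, Matrix.trace_sub, Matrix.mul_sum, Matrix.trace_sum]
  simp only [trace_mul_pureState, Complex.sub_re, Complex.re_sum]
  calc ∑ k, (star (v k) ⬝ᵥ C.mulVec (v k)).re - (star t ⬝ᵥ C.mulVec t).re
      = ∑ k, ((star (v k) ⬝ᵥ C.mulVec (v k)).re
          - normSqVec (v k) * (star t ⬝ᵥ C.mulVec t).re) := by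
        rw [Finset.sum_sub_distrib, ← Finset.sum_mul, hv, one_mul]
    _ ≤ ∑ k, 2 * (√(normSqVec (v k)) * √(normSqVec (v k) - ‖star t ⬝ᵥ v k‖ ^ 2)) :=
        Finset.sum_le_sum fun k _ => re_expectation_sub_le hC hC1 _ _ ht
    _ ≤ 2 * (√(∑ k, normSqVec (v k)) * √(∑ k, (normSqVec (v k) - ‖star t ⬝ᵥ v k‖ ^ 2))) := by
        rw [← Finset.mul_sum]
        gcongr
        exact Real.sum_sqrt_mul_sqrt_le _ (fun k => normSqVec_nonneg _)
          (fun k => sub_nonneg.mpr (hle k))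
    _ = _ := by rw [Finset.sum_sub_distrib, hv, Real.sqrt_one, one_mul]

/-! ### Powers–Størmer, polar decomposition, and closeness of purifications -/

theorem norm_trace_conjTranspose_mul_le {m n : Type} [Fintype m] [Fintype n]
    (A B : Matrix m n ℂ) :
    ‖(A.conjTranspose * B).trace‖ ≤
      √(A.conjTranspose * A).trace.re * √(B.conjTranspose * B).trace.re := by
  simp only [← Matrix.star_vec_dotProduct_vec, re_dotProduct_star_self]
  exact norm_dotProduct_star_le _ _

theorem trace_mul_nonneg {n : Type} [Fintype n] [DecidableEq n] {A B : Matrix n n ℂ}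
    (hA : A.PosSemidef) (hB : B.PosSemidef) : 0 ≤ (A * B).trace.re := by
  obtain ⟨a, ha, hs⟩ : ∃ a : Matrix n n ℂ, a.IsHermitian ∧ a * a = A :=
    ⟨CFC.sqrt A, (Matrix.nonneg_iff_posSemidef.mp (CFC.sqrt_nonneg A)).1,
      CFC.sqrt_mul_sqrt_self A (Matrix.nonneg_iff_posSemidef.mpr hA)⟩
  have h := (hB.conjTranspose_mul_mul_same a).trace_nonneg
  rw [ha.eq, Matrix.trace_mul_comm, ← Matrix.mul_assoc, hs] at h
  exact (Complex.le_def.mp h).1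

/-- The Powers–Størmer inequality. -/
theorem powers_stormer {n : Type} [Fintype n] [DecidableEq n] {S T : Matrix n n ℂ}
    (hS : S.PosSemidef) (hT : T.PosSemidef) {D : ℝ}
    (hD : ∀ C : Matrix n n ℂ, C.IsHermitian → (1 - C * C).PosSemidef →
      (C * (S * S - T * T)).trace.re ≤ D) :
    (S * S).trace.re + (T * T).trace.re - D ≤ 2 * (S * T).trace.re := by
  -- With `C` the sign of `S - T`, commutation gives `tr C (S² - T²) = tr |S - T| (S + T)`. This is
  -- at least `tr (S - T)²`, because `|S - T| ± (S - T)` are nonnegative and are tested against `T`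
  -- and `S`.
  obtain ⟨C, hC, hC1, hcomm, hpos, hneg, -⟩ := exists_sign (hS.1.sub hT.1)
  have h1 := trace_mul_nonneg hpos hT
  have h2 := trace_mul_nonneg hneg hS
  have h3 := hD C hC hC1
  have e1 : (C * S * T).trace - (C * T * T).trace = (S * C * T).trace - (T * C * T).trace := by
    have := congrArg (fun Z => (Z * T).trace) hcomm
    simpa [Matrix.mul_sub, Matrix.sub_mul] using this
  have e2 : (C * S * S).trace - (C * T * S).trace = (S * C * S).trace - (T * C * S).trace := by
    have := congrArg (fun Z => (Z * S).trace) hcomm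
    simpa [Matrix.mul_sub, Matrix.sub_mul] using this
  have e3 : (S * C * T).trace = (C * T * S).trace := by
    rw [Matrix.mul_assoc, Matrix.trace_mul_comm]
  have e4 : (S * C * S).trace = (C * S * S).trace := by
    rw [Matrix.mul_assoc, Matrix.trace_mul_comm]
  have e5 : (T * C * S).trace = (C * S * T).trace := by
    rw [Matrix.mul_assoc, Matrix.trace_mul_comm]
  have e6 : (T * C * T).trace = (C * T * T).trace := by
    rw [Matrix.mul_assoc, Matrix.trace_mul_comm]
  have e7 : (T * S).trace = (S * T).trace := Matrix.trace_mul_comm _ _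
  rw [e3, e6] at e1
  simp only [Matrix.mul_sub, Matrix.add_mul, Matrix.sub_mul, Matrix.trace_add, Matrix.trace_sub,
    Complex.add_re, Complex.sub_re, ← Matrix.mul_assoc, e7] at h1 h2 h3
  have e1' := congrArg Complex.re e1
  simp only [Complex.sub_re] at e1'
  linarith

theorem posSemidef_one_sub_of_partialIsometry {m n : Type} [Fintype m] [Fintype n] [DecidableEq n]
    {W : Matrix m n ℂ} (hW : W * W.conjTranspose * W = W) :
    (1 - W.conjTranspose * W).PosSemidef := by
  have hid : W.conjTranspose * W * (W.conjTranspose * W) = W.conjTranspose * W := by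
    rw [Matrix.mul_assoc, ← Matrix.mul_assoc W, hW]
  have : 1 - W.conjTranspose * W =
      (1 - W.conjTranspose * W).conjTranspose * (1 - W.conjTranspose * W) := by
    rw [Matrix.conjTranspose_sub, Matrix.conjTranspose_mul, Matrix.conjTranspose_conjTranspose,
      Matrix.conjTranspose_one, Matrix.mul_sub, Matrix.sub_mul, Matrix.sub_mul, hid]
    simp
  rw [this]
  exact Matrix.posSemidef_conjTranspose_mul_self _

/-- The polar decomposition `M = S W`, with `S = √(M M†)` and a partial isometry `W`. -/
theorem exists_polar {m n : Type} [Fintype m] [Fintype n] [DecidableEq m] [DecidableEq n]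
    (M : Matrix m n ℂ) :
    ∃ (S : Matrix m m ℂ) (W : Matrix m n ℂ), S.PosSemidef ∧ S * S = M * M.conjTranspose ∧
      S * W = M ∧ W * W.conjTranspose * S = S ∧ W * W.conjTranspose * W = W := by
  have hpos : 0 ≤ M * M.conjTranspose :=
    Matrix.nonneg_iff_posSemidef.mpr (Matrix.posSemidef_self_mul_conjTranspose M)
  set S := CFC.sqrt (M * M.conjTranspose) with hSdef
  have hS0 : 0 ≤ S := CFC.sqrt_nonneg _
  have hSS : S * S = M * M.conjTranspose := CFC.sqrt_mul_sqrt_self _ hpos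
  have hSH : S.IsHermitian := (Matrix.nonneg_iff_posSemidef.mp hS0).1
  have hSs : IsSelfAdjoint S := hSH
  have hc : ∀ f : ℝ → ℝ, ContinuousOn f (spectrum ℝ S) := fun f =>
    (Matrix.finite_real_spectrum).continuousOn f
  have hmul : ∀ f g : ℝ → ℝ, cfc f S * cfc g S = cfc (fun x => f x * g x) S := fun f g =>
    (cfc_mul f g S (hc f) (hc g)).symm
  -- Since `0⁻¹ = 0`, this is the pseudo-inverse of `S`. Hence `S * G` is the projection onto the
  -- support of `S`, and `G * M` is the partial isometry.
  set G := cfc (fun x : ℝ => x⁻¹) S with hG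
  have hGH : G.IsHermitian := cfc_predicate (fun x : ℝ => x⁻¹) S
  have hS1 : cfc (fun x : ℝ => x) S = S := cfc_id' ℝ S
  have hSGS : S * G * S = S := by
    have : cfc (fun x : ℝ => x) S * G * cfc (fun x : ℝ => x) S = cfc (fun x : ℝ => x) S := by
      rw [hG, hmul, hmul]
      congr 1
      ext x
      exact mul_inv_mul_cancel x
    rwa [hS1] at this
  have hGSG : G * S * G = G := by
    have : G * cfc (fun x : ℝ => x) S * G = G := by
      rw [hG, hmul, hmul]
      congr 1
      ext x
      show x⁻¹ * x * x⁻¹ = x⁻¹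
      by_cases h : x = 0 <;> simp [h]
    rwa [hS1] at this
  have hGS : G * S = S * G := by
    have : G * cfc (fun x : ℝ => x) S = cfc (fun x : ℝ => x) S * G := by
      rw [hG, hmul, hmul]
      congr 1
      ext x
      exact mul_comm _ _
    rwa [hS1] at this
  have hM : S * G * M = M := by
    have h0 : (M - S * G * M) * (M - S * G * M).conjTranspose = 0 := by
      have : M - S * G * M = (1 - S * G) * M := by rw [Matrix.sub_mul, Matrix.one_mul]
      rw [this, Matrix.conjTranspose_mul, ← Matrix.mul_assoc, Matrix.mul_assoc _ M, ← hSS,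
        Matrix.sub_mul, Matrix.sub_mul, ← Matrix.mul_assoc (S * G), hSGS, Matrix.one_mul, sub_self]
    exact (sub_eq_zero.mp (Matrix.self_mul_conjTranspose_eq_zero.mp h0)).symm
  have hWW : G * M * (G * M).conjTranspose = S * G := by
    rw [Matrix.conjTranspose_mul, hGH.eq, ← Matrix.mul_assoc, Matrix.mul_assoc G, ← hSS,
      Matrix.mul_assoc G, Matrix.mul_assoc S S G, ← hGS, ← Matrix.mul_assoc S G S, hSGS, hGS]
  refine ⟨S, G * M, Matrix.nonneg_iff_posSemidef.mp hS0, hSS, ?_, ?_, ?_⟩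
  · rw [← Matrix.mul_assoc, hM]
  · rw [hWW, hSGS]
  · rw [hWW, ← Matrix.mul_assoc, Matrix.mul_assoc S G G, ← Matrix.mul_assoc S G G, ← hGS, hGSG]

/-- Two bipartite vectors with close reduced operators are close up to a contraction on the
purifying system. -/
theorem exists_contraction {X Y Z : Type} [Fintype X] [Fintype Y] [Fintype Z]
    [DecidableEq X] [DecidableEq Y] [DecidableEq Z] (M : Matrix X Y ℂ) (T : Matrix X Z ℂ) {D : ℝ}
    (hD : ∀ C : Matrix X X ℂ, C.IsHermitian → (1 - C * C).PosSemidef →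
      (C * (M * M.conjTranspose - T * T.conjTranspose)).trace.re ≤ D) :
    ∃ V : Matrix Z Y ℂ, (1 - V.conjTranspose * V).PosSemidef ∧
      (M * M.conjTranspose).trace.re + (T * T.conjTranspose).trace.re - D ≤
        2 * (T.conjTranspose * M * V.transpose).trace.re := by
  obtain ⟨S, W, hS, hSS, hSW, hWS, hW⟩ := exists_polar M
  obtain ⟨S', W', hS', hSS', hSW', hWS', hW'⟩ := exists_polar T
  rw [← hSS, ← hSS'] at hD ⊢
  -- The choice cancels both partial isometries, leaving the overlap `tr S S'`. The transpose
  -- appears because Bob's operator acts on the column index.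
  refine ⟨(W.conjTranspose * W').transpose, ?_, ?_⟩
  · have h1 : (1 - (W.conjTranspose * W') * (W.conjTranspose * W').conjTranspose).PosSemidef := by
      have hW'' : (1 - W' * W'.conjTranspose).PosSemidef := by
        have h := posSemidef_one_sub_of_partialIsometry (W := W'.conjTranspose) (by
          have := congrArg Matrix.conjTranspose hW'
          simpa [Matrix.conjTranspose_mul, Matrix.mul_assoc] using this)
        rwa [Matrix.conjTranspose_conjTranspose] at h
      have h2 := (posSemidef_one_sub_of_partialIsometry hW).add (hW''.conjTranspose_mul_mul_same W)
      convert h2 using 1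
      simp only [Matrix.conjTranspose_mul, Matrix.conjTranspose_conjTranspose, Matrix.mul_sub,
        Matrix.sub_mul, Matrix.mul_one, Matrix.mul_assoc]
      abel
    have h2 := h1.transpose
    rwa [Matrix.transpose_sub, Matrix.transpose_mul, Matrix.transpose_one] at h2
  · refine (powers_stormer hS hS' hD).trans (le_of_eq ?_)
    have h3 : (T.conjTranspose * M * (W.conjTranspose * W').transpose.transpose).trace
        = (S * S').trace := by
      rw [Matrix.transpose_transpose, ← hSW, ← hSW', Matrix.conjTranspose_mul, hS'.1.eq]
      have a1 : S * W * W.conjTranspose = S := by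
        have := congrArg Matrix.conjTranspose hWS
        simpa [Matrix.conjTranspose_mul, hS.1.eq, Matrix.mul_assoc] using this
      calc (W'.conjTranspose * S' * (S * W) * (W.conjTranspose * W')).trace
          = (W'.conjTranspose * (S' * (S * W * W.conjTranspose) * W')).trace := by
            simp only [Matrix.mul_assoc]
        _ = (S * (W' * W'.conjTranspose * S')).trace := by
            rw [a1, Matrix.trace_mul_comm, Matrix.mul_assoc, Matrix.mul_assoc, Matrix.trace_mul_comm]
            simp only [Matrix.mul_assoc]
        _ = _ := by rw [hWS']
    rw [h3]

/-! ### One-way protocols: branches, Bob's operations, and decoupling as a sufficient condition -/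

theorem isLOCC_oneWay {a b c d : Type} [Fintype a] [DecidableEq a] [Fintype b] [DecidableEq b]
    [Fintype c] [DecidableEq c] [Fintype d] {N m : ℕ}
    {P : Fin N → Matrix c a ℂ} {D : Fin N → Fin m → Matrix d b ℂ}
    (hP : IsMeasurement P) (hD : ∀ j, IsMeasurement (D j)) : IsLOCC (oneWay P D) := by
  have h := IsLOCC.alice (b := b) P hP
    (fun j => ∑ i, (LinearMap.id : Matrix (c × d) (c × d) ℂ →ₗ[ℂ] _).comp
      (conjMap ((1 : Matrix c c ℂ) ⊗ₖ D j i)))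
    (fun j => IsLOCC.bob (a := c) (D j) (hD j) (fun _ => LinearMap.id) fun _ => IsLOCC.done)
  convert h using 1
  refine Finset.sum_congr rfl fun j _ => LinearMap.ext fun ρ => ?_
  simp only [LinearMap.sum_apply, LinearMap.comp_apply, LinearMap.id_apply]
  refine Finset.sum_congr rfl fun i _ => ?_
  have hk : P j ⊗ₖ D j i = ((1 : Matrix c c ℂ) ⊗ₖ D j i) * (P j ⊗ₖ (1 : Matrix b b ℂ)) := by
    rw [← Matrix.mul_kronecker_mul, Matrix.one_mul, Matrix.mul_one]
  simp only [conjMap, LinearMap.coe_mk, AddHom.coe_mk]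
  rw [hk, Matrix.conjTranspose_mul]
  simp only [Matrix.mul_assoc]

/-- The (unnormalized) post-measurement vector, as a matrix from Bob's system to the rest. -/
def branch {a b c R : Type} [Fintype a] (P : Matrix c a ℂ) (φ : (a × b) × R → ℂ) :
    Matrix (c × R) b ℂ :=
  Matrix.of fun p y => ∑ x, P p.1 x * φ ((x, y), p.2)

/-- A linear map of Bob's system, applied to a branch. -/
def applyBob {b c d R : Type} [Fintype b] (V : Matrix d b ℂ) (M : Matrix (c × R) b ℂ) :
    (c × d) × R → ℂ :=
  fun p => ∑ y, V p.1.2 y * M (p.1.1, p.2) y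

/-- Every pair of Kraus operators keeps a pure state pure, so the output is a mixture to which
`traceNorm_sum_pureState_sub_le` applies. -/
theorem tensorId_oneWay {a b c d R : Type} [Fintype a] [Fintype b] {N m : ℕ}
    (P : Fin N → Matrix c a ℂ) (D : Fin N → Fin m → Matrix d b ℂ) (φ : (a × b) × R → ℂ) :
    tensorId R (oneWay P D) (pureState φ) =
      ∑ k : Fin N × Fin m, pureState (applyBob (D k.1 k.2) (branch (P k.1) φ)) := by
  ext p q
  rw [Fintype.sum_prod_type]
  simp only [tensorId, oneWay, Matrix.of_apply, LinearMap.sum_apply, Matrix.sum_apply]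
  refine Finset.sum_congr rfl fun j _ => Finset.sum_congr rfl fun i _ => ?_
  have hvec : ∀ p : (c × d) × R, applyBob (D j i) (branch (P j) φ) p =
      ∑ z : a × b, (P j ⊗ₖ D j i) p.1 z * φ (z, p.2) := by
    intro p
    simp only [applyBob, branch, Matrix.of_apply, Fintype.sum_prod_type_right,
      Matrix.kroneckerMap_apply, Finset.mul_sum]
    refine Finset.sum_congr rfl fun y _ => Finset.sum_congr rfl fun x _ => by ring
  simp only [pureState, Matrix.vecMulVec_apply, Pi.star_apply, hvec, conjMap, LinearMap.coe_mk,
    AddHom.coe_mk, Matrix.mul_apply, Matrix.of_apply, Matrix.conjTranspose_apply, star_sum,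
    Finset.sum_mul, Finset.mul_sum, star_mul']
  refine Finset.sum_congr rfl fun y _ => Finset.sum_congr rfl fun x _ => by ring

theorem IsMeasurement.sum_normSqVec {m n : Type} [Fintype m] [Fintype n] [DecidableEq n] {k : ℕ}
    {M : Fin k → Matrix m n ℂ} (hM : IsMeasurement M) (v : n → ℂ) :
    ∑ x, normSqVec ((M x).mulVec v) = normSqVec v := by
  have h : ∀ x, normSqVec ((M x).mulVec v) =
      (star v ⬝ᵥ ((M x).conjTranspose * M x).mulVec v).re := by
    intro x
    rw [← re_dotProduct_star_self, ← Matrix.mulVec_mulVec, Matrix.dotProduct_mulVec (star v),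
      Matrix.vecMul_conjTranspose, star_star]
  simp only [h]
  rw [← Complex.re_sum, ← dotProduct_sum, ← Matrix.sum_mulVec, hM, Matrix.one_mulVec,
    re_dotProduct_star_self]

theorem sum_comm_reverse {x y z : Type} [Fintype x] [Fintype y] [Fintype z]
    (F : x → y → z → ℝ) : ∑ i, ∑ j, ∑ k, F i j k = ∑ k, ∑ j, ∑ i, F i j k := by
  rw [Finset.sum_comm, Finset.sum_comm (γ := z)]
  exact Finset.sum_congr rfl fun _ _ => Finset.sum_comm

theorem sum_normSq_branch {a b c R : Type} [Fintype a] [DecidableEq a] [Fintype b] [Fintype c]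
    [Fintype R] {N : ℕ} {P : Fin N → Matrix c a ℂ} (hP : IsMeasurement P)
    (φ : (a × b) × R → ℂ) :
    ∑ j, ∑ x, ∑ y, ‖branch (P j) φ x y‖ ^ 2 = normSqVec φ := by
  have h : ∀ j, ∑ x, ∑ y, ‖branch (P j) φ x y‖ ^ 2 =
      ∑ z : b × R, normSqVec ((P j).mulVec fun x => φ ((x, z.1), z.2)) := by
    intro j
    simp only [normSqVec, Matrix.mulVec, dotProduct, branch, Matrix.of_apply,
      Fintype.sum_prod_type]
    exact sum_comm_reverse _
  simp only [h]
  rw [Finset.sum_comm]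
  simp only [hP.sum_normSqVec]
  simp only [normSqVec, Fintype.sum_prod_type]
  rw [sum_comm_reverse]
  exact Finset.sum_congr rfl fun x _ => Finset.sum_comm

theorem sum_normSq_applyBob {b c d R : Type} [Fintype b] [DecidableEq b] [Fintype c] [Fintype d]
    [Fintype R] {m : ℕ} {D : Fin m → Matrix d b ℂ} (hD : IsMeasurement D)
    (M : Matrix (c × R) b ℂ) :
    ∑ i, normSqVec (applyBob (D i) M) = ∑ x, ∑ y, ‖M x y‖ ^ 2 := by
  have h : ∀ i, normSqVec (applyBob (D i) M) = ∑ x, normSqVec ((D i).mulVec (M x)) := by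
    intro i
    simp only [normSqVec, applyBob, Matrix.mulVec, dotProduct, Fintype.sum_prod_type]
    refine Finset.sum_congr rfl fun l _ => Finset.sum_comm
  simp only [h]
  rw [Finset.sum_comm]
  simp only [hD.sum_normSqVec]
  rfl

/-- A contraction is one of the Kraus operators of a quantum operation. -/
theorem exists_kraus {b d : Type} [Fintype b] [DecidableEq b] [Fintype d] [DecidableEq d]
    [Nonempty d] (V : Matrix d b ℂ) (hV : (1 - V.conjTranspose * V).PosSemidef) :
    ∃ D : Fin (Fintype.card b + 1) → Matrix d b ℂ, IsMeasurement D ∧ D 0 = V := by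
  obtain ⟨d₀⟩ := ‹Nonempty d›
  obtain ⟨E, hE⟩ : ∃ E : Matrix b b ℂ, E.conjTranspose * E = 1 - V.conjTranspose * V := by
    refine ⟨CFC.sqrt (1 - V.conjTranspose * V), ?_⟩
    rw [(Matrix.nonneg_iff_posSemidef.mp (CFC.sqrt_nonneg _)).1.eq]
    exact CFC.sqrt_mul_sqrt_self _ (Matrix.nonneg_iff_posSemidef.mpr hV)
  -- The missing weight `1 - V† V = E† E` is dumped on the fixed basis vector `d₀`, with one
  -- operator `|d₀⟩⟨k| E` for each row `k` of `E`.
  refine ⟨Fin.cons V fun k => Matrix.of fun i y =>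
    if i = d₀ then E ((Fintype.equivFin b).symm k) y else 0, ?_, rfl⟩
  rw [IsMeasurement, Fin.sum_univ_succ]
  simp only [Fin.cons_zero, Fin.cons_succ]
  rw [eq_comm, ← sub_eq_iff_eq_add', ← hE]
  ext y y'
  rw [Matrix.sum_apply, Matrix.mul_apply, ← (Fintype.equivFin b).symm.sum_comp]
  refine Finset.sum_congr rfl fun k _ => ?_
  simp [Matrix.mul_apply, Matrix.conjTranspose_apply]

/-- Alice measures, and Bob applies quantum operations that extend given contractions. -/
theorem exists_oneWay_of_contractions {a b c d R : Type} [Fintype a] [DecidableEq a] [Fintype b]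
    [DecidableEq b] [Fintype c] [DecidableEq c] [Fintype d] [DecidableEq d] [Nonempty d]
    [Fintype R] [DecidableEq R] {N : ℕ} {P : Fin N → Matrix c a ℂ} (hP : IsMeasurement P)
    {φ : (a × b) × R → ℂ} (hφ : normSqVec φ = 1) {t : (c × d) × R → ℂ} (ht : normSqVec t = 1)
    (V : Fin N → Matrix d b ℂ) (hV : ∀ j, (1 - (V j).conjTranspose * V j).PosSemidef) :
    ∃ D : Fin N → Fin (Fintype.card b + 1) → Matrix d b ℂ, (∀ j, IsMeasurement (D j)) ∧
      IsLOCC (oneWay P D) ∧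
      traceNorm (tensorId R (oneWay P D) (pureState φ) - pureState t) ≤
        2 * √(1 - ∑ j, ‖star t ⬝ᵥ applyBob (V j) (branch (P j) φ)‖ ^ 2) := by
  choose D hD hD0 using fun j => exists_kraus (V j) (hV j)
  refine ⟨D, hD, isLOCC_oneWay hP hD, ?_⟩
  rw [tensorId_oneWay]
  refine (traceNorm_sum_pureState_sub_le _ t ht ?_).trans ?_
  · rw [Fintype.sum_prod_type]
    simp only [sum_normSq_applyBob (hD _)]
    rw [sum_normSq_branch hP, hφ]
  · gcongr
    rw [Fintype.sum_prod_type]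
    refine Finset.sum_le_sum fun j _ => ?_
    rw [← hD0 j]
    -- The Kraus operators other than `V j` can only increase the fidelity, so they are dropped from
    -- the bound.
    exact Finset.single_le_sum
      (f := fun i => ‖star t ⬝ᵥ applyBob (D j i) (branch (P j) φ)‖ ^ 2)
      (fun _ _ => by positivity) (Finset.mem_univ 0)

/-- A vector as a matrix from Bob's system to the rest. -/
def asMatrix {c d R : Type} (t : (c × d) × R → ℂ) : Matrix (c × R) d ℂ :=
  Matrix.of fun p y => t ((p.1, y), p.2)

theorem star_dotProduct_applyBob {b c d R : Type} [Fintype b] [Fintype c] [Fintype d]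
    [Fintype R] (t : (c × d) × R → ℂ) (V : Matrix d b ℂ) (M : Matrix (c × R) b ℂ) :
    star t ⬝ᵥ applyBob V M = ((asMatrix t).conjTranspose * M * V.transpose).trace := by
  simp only [dotProduct, applyBob, Matrix.trace, Matrix.diag, Matrix.mul_apply, asMatrix,
    Matrix.of_apply, Matrix.conjTranspose_apply, Matrix.transpose_apply, Pi.star_apply,
    Fintype.sum_prod_type, Finset.mul_sum, Finset.sum_mul]
  rw [Finset.sum_comm]
  refine Finset.sum_congr rfl fun y' _ => ?_
  have : ∀ l, (∑ r, ∑ y, star (t ((l, y'), r)) * (V y' y * M (l, r) y)) =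
      ∑ y, ∑ r, star (t ((l, y'), r)) * M (l, r) y * V y' y := by
    intro l
    rw [Finset.sum_comm]
    refine Finset.sum_congr rfl fun y _ => Finset.sum_congr rfl fun r _ => by ring
  simp only [this]
  rw [Finset.sum_comm]

theorem re_trace_mul_conjTranspose_self {m n : Type} [Fintype m] [Fintype n]
    (M : Matrix m n ℂ) : (M * M.conjTranspose).trace.re = ∑ x, ∑ y, ‖M x y‖ ^ 2 := by
  simp only [Matrix.trace, Matrix.diag, Matrix.mul_apply, Matrix.conjTranspose_apply,
    Complex.re_sum, Complex.star_def, Complex.mul_conj']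
  refine Finset.sum_congr rfl fun x _ => Finset.sum_congr rfl fun y _ => by norm_cast

theorem asMatrix_mul_conjTranspose_trace {c d R : Type} [Fintype c] [Fintype d] [Fintype R]
    (t : (c × d) × R → ℂ) : (asMatrix t * (asMatrix t).conjTranspose).trace.re = normSqVec t := by
  rw [re_trace_mul_conjTranspose_self]
  simp only [asMatrix, normSqVec, Fintype.sum_prod_type, Matrix.of_apply]
  exact Finset.sum_congr rfl fun l _ => Finset.sum_comm

/-- If Alice's measurement decouples her output from the reference, then Bob can complete the
process to one that approximately produces the target. -/
theorem exists_oneWay_of_decoupled {a b c d R : Type} [Fintype a] [DecidableEq a] [Fintype b]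
    [DecidableEq b] [Fintype c] [DecidableEq c] [Fintype d] [DecidableEq d] [Nonempty d]
    [Fintype R] [DecidableEq R] {N : ℕ} {P : Fin N → Matrix c a ℂ} (hP : IsMeasurement P)
    {φ : (a × b) × R → ℂ} (hφ : normSqVec φ = 1) {t : (c × d) × R → ℂ} (ht : normSqVec t = 1)
    (q e : Fin N → ℝ) (hq : ∀ j, 0 ≤ q j) (hq1 : ∑ j, q j = 1)
    (he : ∀ j, ∀ C : Matrix (c × R) (c × R) ℂ, C.IsHermitian → (1 - C * C).PosSemidef →
      (C * (branch (P j) φ * (branch (P j) φ).conjTranspose -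
        (q j : ℂ) • (asMatrix t * (asMatrix t).conjTranspose))).trace.re ≤ e j) :
    ∃ D : Fin N → Fin (Fintype.card b + 1) → Matrix d b ℂ, (∀ j, IsMeasurement (D j)) ∧
      IsLOCC (oneWay P D) ∧
      traceNorm (tensorId R (oneWay P D) (pureState φ) - pureState t) ≤
        2 * √(∑ j, e j) := by
  have hT : ∀ j, ((√(q j) : ℂ) • asMatrix t) * ((√(q j) : ℂ) • asMatrix t).conjTranspose =
      (q j : ℂ) • (asMatrix t * (asMatrix t).conjTranspose) := by
    intro j
    rw [Matrix.conjTranspose_smul, Matrix.smul_mul, Matrix.mul_smul, smul_smul, Complex.star_def,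
      Complex.conj_ofReal, ← Complex.ofReal_mul, Real.mul_self_sqrt (hq j)]
  have hex := fun j => exists_contraction (branch (P j) φ) ((√(q j) : ℂ) • asMatrix t) (D := e j)
    (by rw [hT]; exact he j)
  choose V hV hVle using hex
  obtain ⟨D, hD, hL, hle⟩ := exists_oneWay_of_contractions hP hφ ht V hV
  refine ⟨D, hD, hL, hle.trans ?_⟩
  have hp : ∑ j, (branch (P j) φ * (branch (P j) φ).conjTranspose).trace.re = 1 := by
    simp only [re_trace_mul_conjTranspose_self, sum_normSq_branch hP, hφ]
  have htt : (asMatrix t * (asMatrix t).conjTranspose).trace.re = 1 := by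
    rw [asMatrix_mul_conjTranspose_trace, ht]
  set f : Fin N → ℂ := fun j => star t ⬝ᵥ applyBob (V j) (branch (P j) φ) with hf
  have hj : ∀ j, (branch (P j) φ * (branch (P j) φ).conjTranspose).trace.re + q j - e j ≤
      2 * (√(q j) * ‖f j‖) := by
    intro j
    have h := hVle j
    rw [hT, Matrix.trace_smul, smul_eq_mul, Complex.re_ofReal_mul, htt, mul_one,
      Matrix.conjTranspose_smul, Matrix.smul_mul, Matrix.smul_mul, Matrix.trace_smul,
      ← star_dotProduct_applyBob, smul_eq_mul, Complex.star_def, Complex.conj_ofReal,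
      Complex.re_ofReal_mul] at h
    refine h.trans ?_
    gcongr
    exact Complex.re_le_norm _
  have hsum := Finset.sum_le_sum fun j (_ : j ∈ Finset.univ) => hj j
  rw [Finset.sum_sub_distrib, Finset.sum_add_distrib, hp, hq1, ← Finset.mul_sum] at hsum
  have hcs : ∑ j, √(q j) * ‖f j‖ ≤ √(∑ j, ‖f j‖ ^ 2) := by
    have h := Real.sum_mul_le_sqrt_mul_sqrt Finset.univ (fun j => √(q j)) (fun j => ‖f j‖)
    simp only [Real.sq_sqrt (hq _), hq1, Real.sqrt_one, one_mul] at h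
    exact h
  have hF0 : 0 ≤ ∑ j, ‖f j‖ ^ 2 := Finset.sum_nonneg fun _ _ => by positivity
  have hF := Real.sq_sqrt hF0
  gcongr
  -- With `F = ∑ ‖f j‖²`, summing over the outcomes gave `2 - ∑ e j ≤ 2 √F`, and `1 - F ≤ 2 (1 -
  -- √F)`.
  nlinarith [Real.sqrt_nonneg (∑ j, ‖f j‖ ^ 2), sq_nonneg (√(∑ j, ‖f j‖ ^ 2) - 1)]

/-! ### The Haar probability measure on the unitary group -/

instance isHaarMeasure_haarUnitary (n : Type) [Fintype n] [DecidableEq n] :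
    (haarUnitary n).IsHaarMeasure := by
  unfold haarUnitary
  infer_instance

instance isProbabilityMeasure_haarUnitary (n : Type) [Fintype n] [DecidableEq n] :
    IsProbabilityMeasure (haarUnitary n) := ⟨by
  have h := Measure.haarMeasure_self
    (K₀ := (⊤ : TopologicalSpace.PositiveCompacts (Matrix.unitaryGroup n ℂ)))
  simpa [haarUnitary] using h⟩

/-- A right translate of a left Haar probability measure is again one, and there is only one. Right
invariance is what allows a fixed unitary to be inserted into the moments below. -/
instance isMulRightInvariant_haarUnitary (n : Type) [Fintype n] [DecidableEq n] :
    (haarUnitary n).IsMulRightInvariant := ⟨fun g => by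
  have : IsProbabilityMeasure ((haarUnitary n).map (· * g)) :=
    Measure.isProbabilityMeasure_map (by fun_prop)
  exact Measure.isHaarMeasure_eq_of_isProbabilityMeasure _ _⟩

theorem integrable_haarUnitary_of_continuous {n F : Type} [Fintype n] [DecidableEq n]
    [NormedAddCommGroup F] {f : Matrix.unitaryGroup n ℂ → F} (hf : Continuous f) :
    Integrable f (haarUnitary n) :=
  hf.integrable_of_hasCompactSupport (HasCompactSupport.of_compactSpace f)

theorem exists_perm_pair {n : Type} [DecidableEq n] {i k i' k' : n} (h : i ≠ k) (h' : i' ≠ k') :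
    ∃ π : Equiv.Perm n, π i = i' ∧ π k = k' := by
  have hne : Equiv.swap i i' k ≠ i' := by
    intro he
    have := congrArg (Equiv.swap i i') he
    rw [Equiv.swap_apply_self, Equiv.swap_apply_right] at this
    exact h this.symm
  refine ⟨(Equiv.swap i i').trans (Equiv.swap (Equiv.swap i i' k) k'), ?_, ?_⟩
  · simp [Equiv.swap_apply_of_ne_of_ne hne.symm h']
  · simp

/-! ### Second moments of a randomly rotated projection -/

section Twirl

variable {n : Type} [Fintype n] [DecidableEq n]

/-- `U† E U`. -/
def rotated (E : Matrix n n ℂ) (U : Matrix.unitaryGroup n ℂ) : Matrix n n ℂ :=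
  (U : Matrix n n ℂ).conjTranspose * E * (U : Matrix n n ℂ)

theorem continuous_rotated (E : Matrix n n ℂ) : Continuous (rotated E) :=
  ((continuous_subtype_val.matrix_conjTranspose).matrix_mul continuous_const).matrix_mul
    continuous_subtype_val

theorem continuous_rotated_apply (E : Matrix n n ℂ) (i j : n) :
    Continuous fun U => rotated E U i j :=
  (continuous_rotated E).matrix_elem i j

/-- Second moments of the entries of `U† E U` for a Haar random `U`. -/
noncomputable def moment (E : Matrix n n ℂ) (i j k l : n) : ℂ :=
  ∫ U, rotated E U i j * rotated E U k l ∂(haarUnitary n)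

theorem integrable_rotated_mul (E : Matrix n n ℂ) (i j k l : n) :
    Integrable (fun U => rotated E U i j * rotated E U k l) (haarUnitary n) :=
  integrable_haarUnitary_of_continuous
    ((continuous_rotated_apply E i j).mul (continuous_rotated_apply E k l))

theorem integral_sum_mul_rotated (E : Matrix n n ℂ) {κ : Type} [Fintype κ] (c : κ → ℂ)
    (i j k l : κ → n) :
    ∫ U, ∑ x, c x * (rotated E U (i x) (j x) * rotated E U (k x) (l x)) ∂(haarUnitary n) =
      ∑ x, c x * moment E (i x) (j x) (k x) (l x) := by
  rw [integral_finsetSum _ fun x _ => (integrable_rotated_mul E _ _ _ _).const_mul _]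
  simp only [integral_const_mul, moment]

/-- Substituting `U V` for `U` yields all the relations among moments that are needed: `V` will be a
diagonal phase, a permutation matrix, or a reflection. -/
theorem moment_invariant (E : Matrix n n ℂ) {V : Matrix n n ℂ} (hV : V.conjTranspose * V = 1)
    (i j k l : n) :
    moment E i j k l = ∫ U, (V.conjTranspose * rotated E U * V) i j *
      (V.conjTranspose * rotated E U * V) k l ∂(haarUnitary n) := by
  have h := integral_mul_right_eq_self (μ := haarUnitary n)
    (fun U => rotated E U i j * rotated E U k l) ⟨V, Matrix.mem_unitaryGroup_iff'.mpr hV⟩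
  rw [moment, ← h]
  congr 1
  ext U
  simp only [rotated, Submonoid.coe_mul, Matrix.conjTranspose_mul, Matrix.mul_assoc]

theorem moment_eq_zero (E : Matrix n n ℂ) {i j k l : n} (h1 : ¬(i = j ∧ k = l))
    (h2 : ¬(i = l ∧ j = k)) : moment E i j k l = 0 := by
  -- Putting a phase on the single basis vector `p` multiplies the moment by this number. The phase
  -- is `I` rather than `-1` so that the moments `i k i k` with `i ≠ k` also pick up a nontrivial
  -- factor.
  obtain ⟨p, hp⟩ : ∃ p : n,
      (if i = p then -Complex.I else 1) * (if j = p then Complex.I else 1) *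
        ((if k = p then -Complex.I else 1) * (if l = p then Complex.I else 1)) ≠ 1 := by
    have hI : Complex.I ≠ 1 := by simp [Complex.ext_iff]
    have hI' : -Complex.I ≠ 1 := by simp [Complex.ext_iff]
    have hm : (-1 : ℂ) ≠ 1 := by norm_num
    by_cases hi : i = j ∨ i = l
    · refine ⟨k, ?_⟩
      rcases hi with rfl | rfl
      · have hkl : l ≠ k := fun h => h1 ⟨rfl, h.symm⟩
        by_cases hk : i = k <;> simp [hk, hkl, hI']
      · have hkl : j ≠ k := fun h => h2 ⟨rfl, h⟩
        by_cases hk : i = k <;> simp [hk, hkl, hI']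
    · push Not at hi
      refine ⟨i, ?_⟩
      by_cases hk : k = i <;> simp [hk, hi.1.symm, hi.2.symm, hI', hm]
  set d : n → ℂ := fun x => if x = p then Complex.I else 1 with hd
  have hV : (Matrix.diagonal d).conjTranspose * Matrix.diagonal d = 1 := by
    rw [Matrix.diagonal_conjTranspose, Matrix.diagonal_mul_diagonal, ← Matrix.diagonal_one]
    congr 1
    ext x
    by_cases hx : x = p <;> simp [hd, hx]
  have hstar : ∀ x, star (d x) = if x = p then -Complex.I else 1 := by
    intro x
    by_cases hx : x = p <;> simp [hd, hx]
  have h := moment_invariant E hV i j k l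
  have h' : moment E i j k l = (star (d i) * d j * (star (d k) * d l)) * moment E i j k l := by
    conv_lhs => rw [h]
    rw [moment, ← integral_const_mul]
    congr 1
    ext U
    simp only [Matrix.diagonal_conjTranspose, Matrix.mul_diagonal, Matrix.diagonal_mul,
      Pi.star_apply]
    ring
  rw [hstar, hstar] at h'
  by_contra hne
  exact hp (mul_right_cancel₀ hne (by rw [one_mul]; exact h'.symm))

theorem moment_perm (E : Matrix n n ℂ) (π : Equiv.Perm n) (i j k l : n) :
    moment E (π i) (π j) (π k) (π l) = moment E i j k l := by
  set V : Matrix n n ℂ := (1 : Matrix n n ℂ).submatrix id π with hV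
  have hV1 : V.conjTranspose * V = 1 := by
    ext x y
    simp [hV, Matrix.mul_apply, Matrix.one_apply]
  rw [moment_invariant E hV1 i j k l, moment]
  congr 1
  ext U
  have : ∀ x y, (V.conjTranspose * rotated E U * V) x y = rotated E U (π x) (π y) := by
    intro x y
    simp [hV, Matrix.mul_apply, Matrix.one_apply]
  rw [this, this]

/-- Invariance under a reflection that mixes `i` and `k` gives it. If the `i`-th column is `(c, s)`
with `c² + s² = 1`, expansion yields `M = (c⁴ + s⁴) M + 2 c² s² (x + y)`, where `M` is the left side
and `x`, `y` are the summants on the right, and `1 - c⁴ - s⁴ = 2 c² s²`. -/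
theorem moment_diag_eq_add (E : Matrix n n ℂ) {i k : n} (hik : i ≠ k) :
    moment E i i i i = moment E i i k k + moment E i k k i := by
  have hki : k ≠ i := hik.symm
  -- The Householder reflection along `e_i + 2 e_k` is rational, with `i`-th column `(3/5, -4/5)`;
  -- here `2 c² s² = 288/625`.
  set w : n → ℂ := fun x => if x = i then 1 else if x = k then 2 else 0 with hw
  set V : Matrix n n ℂ := 1 - (2 / 5 : ℂ) • Matrix.vecMulVec w w with hV
  have hww : w ⬝ᵥ w = 5 := by
    have : ∀ x, w x * w x = (if x = i then (1 : ℂ) else 0) + (if x = k then (4 : ℂ) else 0) := by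
      intro x
      by_cases hx : x = i
      · simp [hw, hx, hik]
      · by_cases hx' : x = k <;> simp [hw, hx, hx', hki]
        norm_num
    simp only [dotProduct, this, Finset.sum_add_distrib]
    simp
    norm_num
  have hsw : star w = w := by
    ext x
    simp only [hw, Pi.star_apply]
    split_ifs <;> simp
  have hVH : V.conjTranspose = V := by
    rw [hV, Matrix.conjTranspose_sub, Matrix.conjTranspose_smul, Matrix.conjTranspose_vecMulVec,
      hsw]
    simp
  have hV1 : V.conjTranspose * V = 1 := by
    rw [hVH, hV]
    simp only [Matrix.mul_sub, Matrix.sub_mul, Matrix.one_mul, Matrix.mul_one, Matrix.smul_mul,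
      Matrix.mul_smul, Matrix.vecMulVec_mul_vecMulVec, hww]
    ext x y
    simp [Matrix.vecMulVec_apply]
    ring
  set z : Fin 2 → n := ![i, k] with hz
  set v : Fin 2 → ℂ := ![3 / 5, -4 / 5] with hv
  have hcol : ∀ f : n → ℂ, ∑ x, V x i * f x = ∑ p, v p * f (z p) := by
    intro f
    have : ∀ x, V x i * f x = (if x = i then 3 / 5 * f x else 0) +
        (if x = k then -4 / 5 * f x else 0) := by
      intro x
      by_cases hx : x = i
      · subst hx
        rw [if_pos rfl, if_neg hik, add_zero]
        congr 1
        simp [hV, hw, Matrix.vecMulVec_apply]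
        norm_num
      · by_cases hx' : x = k
        · subst hx'
          simp [hV, hw, hki, Matrix.vecMulVec_apply]
          ring_nf
        · simp [hV, hw, hx, hx', Matrix.vecMulVec_apply]
    simp only [this, Finset.sum_add_distrib]
    simp [hv, hz]
  have hent : ∀ U, (V.conjTranspose * rotated E U * V) i i =
      ∑ p, ∑ q, v p * v q * rotated E U (z p) (z q) := by
    intro U
    have hsym : ∀ x, V i x = V x i := by
      intro x
      simp [hV, Matrix.vecMulVec_apply, Matrix.one_apply, eq_comm, mul_comm]
    rw [hVH, Matrix.mul_apply]
    simp only [Matrix.mul_apply, hsym]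
    calc ∑ x, (∑ y, V y i * rotated E U y x) * V x i
        = ∑ x, V x i * ∑ p, v p * rotated E U (z p) x := by
          refine Finset.sum_congr rfl fun x _ => ?_
          rw [hcol (fun y => rotated E U y x), mul_comm]
      _ = ∑ q, v q * ∑ p, v p * rotated E U (z p) (z q) :=
          hcol fun x => ∑ p, v p * rotated E U (z p) x
      _ = _ := by
          simp only [Finset.mul_sum]
          rw [Finset.sum_comm]
          refine Finset.sum_congr rfl fun p _ => Finset.sum_congr rfl fun q _ => by ring
  have hmom : moment E i i i i = ∑ a : (Fin 2 × Fin 2) × (Fin 2 × Fin 2),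
      v a.1.1 * v a.1.2 * (v a.2.1 * v a.2.2) *
        moment E (z a.1.1) (z a.1.2) (z a.2.1) (z a.2.2) := by
    rw [moment_invariant E hV1, ← integral_sum_mul_rotated]
    congr 1
    ext U
    simp only [hent, Fintype.sum_prod_type, Fin.sum_univ_two]
    ring
  simp only [Fintype.sum_prod_type, Fin.sum_univ_two, hz, hv, Matrix.cons_val_zero,
    Matrix.cons_val_one] at hmom
  have e1 : moment E k k k k = moment E i i i i := by
    simpa using moment_perm E (Equiv.swap i k) i i i i
  have e2 : moment E k k i i = moment E i i k k := by
    simpa using moment_perm E (Equiv.swap i k) i i k k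
  have e3 : moment E k i i k = moment E i k k i := by
    simpa using moment_perm E (Equiv.swap i k) i k k i
  have z1 : moment E i i i k = 0 := moment_eq_zero E (by simp [hik]) (by simp [hik])
  have z2 : moment E i i k i = 0 := moment_eq_zero E (by simp [hki]) (by simp [hik])
  have z3 : moment E i k i i = 0 := moment_eq_zero E (by simp [hik]) (by simp [hki])
  have z4 : moment E k i i i = 0 := moment_eq_zero E (by simp [hki]) (by simp [hki])
  have z5 : moment E i k i k = 0 := moment_eq_zero E (by simp [hik]) (by simp [hik])
  have z6 : moment E k i k i = 0 := moment_eq_zero E (by simp [hki]) (by simp [hki])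
  have z7 : moment E i k k k = 0 := moment_eq_zero E (by simp [hik]) (by simp [hik])
  have z8 : moment E k i k k = 0 := moment_eq_zero E (by simp [hki]) (by simp [hik])
  have z9 : moment E k k i k = 0 := moment_eq_zero E (by simp [hik]) (by simp [hki])
  have z10 : moment E k k k i = 0 := moment_eq_zero E (by simp [hki]) (by simp [hki])
  simp only [e1, e2, e3, z1, z2, z3, z4, z5, z6, z7, z8, z9, z10] at hmom
  linear_combination 625 / 288 * hmom

theorem moment_diag_const (E : Matrix n n ℂ) (i k : n) :
    moment E i i i i = moment E k k k k := by
  simpa using (moment_perm E (Equiv.swap i k) i i i i).symm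

theorem rotated_posSemidef {E : Matrix n n ℂ} (hE : E.PosSemidef) (U : Matrix.unitaryGroup n ℂ) :
    (rotated E U).PosSemidef := hE.conjTranspose_mul_mul_same _

theorem rotated_mul_rotated {E : Matrix n n ℂ} (hE : E * E = E) (U : Matrix.unitaryGroup n ℂ) :
    rotated E U * rotated E U = rotated E U := by
  have hU : (U : Matrix n n ℂ) * (U : Matrix n n ℂ).conjTranspose = 1 :=
    Matrix.mem_unitaryGroup_iff.mp U.2
  simp only [rotated]
  calc _ = (U : Matrix n n ℂ).conjTranspose * E *
        ((U : Matrix n n ℂ) * (U : Matrix n n ℂ).conjTranspose) * E * U := by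
        simp only [Matrix.mul_assoc]
    _ = _ := by rw [hU, Matrix.mul_one, Matrix.mul_assoc _ E E, hE]

theorem trace_rotated (E : Matrix n n ℂ) (U : Matrix.unitaryGroup n ℂ) :
    (rotated E U).trace = E.trace := by
  have hU : (U : Matrix n n ℂ) * (U : Matrix n n ℂ).conjTranspose = 1 :=
    Matrix.mem_unitaryGroup_iff.mp U.2
  rw [rotated, Matrix.trace_mul_comm, ← Matrix.mul_assoc, hU, Matrix.one_mul]

/-- Phases kill all other moments, permutations make those of each kind equal, and the reflection
ties the diagonal ones to `a + b`. Recording that `a` and `b` are moments themselves (or zero) lets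
their sign be read off later. -/
theorem exists_moment_eq (E : Matrix n n ℂ) :
    ∃ a b : ℂ, (∀ i j k l, moment E i j k l =
      (if i = j ∧ k = l then a else 0) + if i = l ∧ j = k then b else 0) ∧
      ((∃ i k, a = moment E i i k k) ∨ a = 0) ∧ ((∃ i k, b = moment E i k k i) ∨ b = 0) := by
  have key : ∀ a b : ℂ, (∀ i k, i ≠ k → moment E i i k k = a ∧ moment E i k k i = b) →
      (∀ i, moment E i i i i = a + b) → ∀ i j k l, moment E i j k l =
      (if i = j ∧ k = l then a else 0) + if i = l ∧ j = k then b else 0 := by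
    intro a b h1 h2 i j k l
    by_cases hA : i = j ∧ k = l
    · obtain ⟨rfl, rfl⟩ := hA
      by_cases hB : i = k
      · subst hB; simp [h2]
      · simp [hB, h1 i k hB]
    · by_cases hB : i = l ∧ j = k
      · obtain ⟨rfl, rfl⟩ := hB
        have hij : i ≠ j := fun h => hA ⟨h, h.symm⟩
        simp [hij, h1 i j hij]
      · simp [hA, hB, moment_eq_zero E hA hB]
  cases subsingleton_or_nontrivial n with
  | inl hs =>
    cases isEmpty_or_nonempty n with
    | inl he => exact ⟨0, 0, fun i => he.elim i, Or.inr rfl, Or.inr rfl⟩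
    | inr hne =>
      obtain ⟨i₀⟩ := hne
      -- In dimension one only `a + b` is determined; the split is arbitrary.
      refine ⟨moment E i₀ i₀ i₀ i₀, 0, key _ _ (fun i k h => (h (Subsingleton.elim i k)).elim)
        fun i => ?_, Or.inl ⟨i₀, i₀, rfl⟩, Or.inr rfl⟩
      rw [add_zero, moment_diag_const E i i₀]
  | inr hnt =>
    obtain ⟨i₀, k₀, h₀⟩ := exists_pair_ne n
    refine ⟨moment E i₀ i₀ k₀ k₀, moment E i₀ k₀ k₀ i₀, key _ _ (fun i k h => ?_) (fun i => ?_),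
      Or.inl ⟨_, _, rfl⟩, Or.inl ⟨_, _, rfl⟩⟩
    · obtain ⟨π, rfl, rfl⟩ := exists_perm_pair h₀ h
      exact ⟨moment_perm E π _ _ _ _, moment_perm E π _ _ _ _⟩
    · rw [moment_diag_const E i i₀, moment_diag_eq_add E h₀]

/-- The second moments of a Haar random projection. -/
theorem exists_moment_projection {E : Matrix n n ℂ} (hE : E.PosSemidef) (hEE : E * E = E)
    {L : ℕ} (hL : E.trace = L) :
    ∃ a b : ℝ, 0 ≤ a ∧ 0 ≤ b ∧ (Fintype.card n : ℝ) ^ 2 * a + Fintype.card n * b = L ^ 2 ∧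
      (Fintype.card n : ℝ) ^ 2 * b + Fintype.card n * a = L ∧
      ∀ i j k l, moment E i j k l =
        (if i = j ∧ k = l then (a : ℂ) else 0) + if i = l ∧ j = k then (b : ℂ) else 0 := by
  -- Since `U† E U` is nonnegative, these moments integrate products of nonnegative diagonal
  -- entries, and those in `hoff` integrate squared moduli.
  have hdiag : ∀ i k, ∃ r : ℝ, 0 ≤ r ∧ moment E i i k k = r := by
    intro i k
    have hr : ∀ U i, rotated E U i i = ((rotated E U i i).re : ℂ) := fun U i =>
      (Complex.eq_re_of_ofReal_le (r := 0) (by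
        simpa using (rotated_posSemidef hE U).diag_nonneg (i := i)))
    have h0 : ∀ U i, 0 ≤ (rotated E U i i).re := fun U i =>
      (Complex.le_def.mp ((rotated_posSemidef hE U).diag_nonneg (i := i))).1
    refine ⟨∫ U, (rotated E U i i).re * (rotated E U k k).re ∂(haarUnitary n),
      integral_nonneg fun U => mul_nonneg (h0 U i) (h0 U k), ?_⟩
    rw [moment, ← integral_complex_ofReal]
    congr 1
    ext U
    rw [hr U i, hr U k]
    simp
  have hoff : ∀ i k, ∃ r : ℝ, 0 ≤ r ∧ moment E i k k i = r := by
    intro i k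
    refine ⟨∫ U, ‖rotated E U i k‖ ^ 2 ∂(haarUnitary n),
      integral_nonneg fun U => by positivity, ?_⟩
    rw [moment, ← integral_complex_ofReal]
    congr 1
    ext U
    rw [← (rotated_posSemidef hE U).1.apply k i, Complex.star_def, Complex.mul_conj']
    simp
  obtain ⟨a, b, hm, ha, hb⟩ := exists_moment_eq E
  obtain ⟨a, ha0, rfl⟩ : ∃ r : ℝ, 0 ≤ r ∧ a = r := by
    rcases ha with ⟨i, k, rfl⟩ | rfl
    · exact hdiag i k
    · exact ⟨0, le_rfl, by simp⟩
  obtain ⟨b, hb0, rfl⟩ : ∃ r : ℝ, 0 ≤ r ∧ b = r := by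
    rcases hb with ⟨i, k, rfl⟩ | rfl
    · exact hoff i k
    · exact ⟨0, le_rfl, by simp⟩
  -- The two equations for `a` and `b` are the averages of `(tr P)² = L²` and `tr P² = L` for the
  -- rotated projection `P`.
  have s1 := integral_sum_mul_rotated E (κ := n × n) (fun _ => 1) (fun x => x.1) (fun x => x.1)
    (fun x => x.2) (fun x => x.2)
  have s2 := integral_sum_mul_rotated E (κ := n × n) (fun _ => 1) (fun x => x.1) (fun x => x.2)
    (fun x => x.2) (fun x => x.1)
  have t1 : ∀ U, ∑ x : n × n, (1 : ℂ) * (rotated E U x.1 x.1 * rotated E U x.2 x.2) = L ^ 2 := by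
    intro U
    simp only [one_mul, Fintype.sum_prod_type, ← Finset.mul_sum, ← Finset.sum_mul]
    rw [sq, ← hL, ← trace_rotated E U]
    rfl
  have t2 : ∀ U, ∑ x : n × n, (1 : ℂ) * (rotated E U x.1 x.2 * rotated E U x.2 x.1) = L := by
    intro U
    simp only [one_mul, Fintype.sum_prod_type]
    rw [← hL, ← trace_rotated E U]
    conv_rhs => rw [← rotated_mul_rotated hEE U]
    simp only [Matrix.trace, Matrix.diag, Matrix.mul_apply]
  simp only [t1, integral_const, probReal_univ, one_smul] at s1
  simp only [t2, integral_const, probReal_univ, one_smul] at s2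
  rw [Fintype.sum_prod_type] at s1 s2
  simp only [one_mul, hm] at s1 s2
  have u1 : ∑ x : n, ∑ y : n, (((if x = x ∧ y = y then (a : ℂ) else 0) +
      if x = y ∧ x = y then (b : ℂ) else 0)) = (Fintype.card n : ℂ) ^ 2 * a + Fintype.card n * b := by
    simp [Finset.sum_add_distrib]
    ring
  have u2 : ∑ x : n, ∑ y : n, (((if x = y ∧ y = x then (a : ℂ) else 0) +
      if x = x ∧ y = y then (b : ℂ) else 0)) = (Fintype.card n : ℂ) ^ 2 * b + Fintype.card n * a := by
    have : ∀ x y : n, (x = y ∧ y = x) ↔ x = y := fun x y => ⟨fun h => h.1, fun h => ⟨h, h.symm⟩⟩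
    simp [Finset.sum_add_distrib, this]
    ring
  replace s1 := s1.trans (Eq.trans (by simp only) u1)
  replace s2 := s2.trans (Eq.trans (by simp only) u2)
  exact ⟨a, b, ha0, hb0, by exact_mod_cast s1.symm, by exact_mod_cast s2.symm, hm⟩

end Twirl

/-! ### Decoupling by a random unitary -/

/-- Cauchy–Schwarz twice: first for the pair `S C S`, `X`, then for `S² C`, `C S²`, whose inner
product is `‖S C S‖₂²` and whose norms are both at most `√(tr S⁴)`. With `S = id ⊗ σ^(1/4)` it
bounds a trace norm by a weighted Hilbert–Schmidt norm. -/
theorem re_trace_mul_weighted_le {n : Type} [Fintype n] [DecidableEq n] {C S X : Matrix n n ℂ}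
    (hC : C.IsHermitian) (hC1 : (1 - C * C).PosSemidef) (hS : S.IsHermitian)
    (hX : X.IsHermitian) :
    (C * (S * X * S)).trace.re ≤ √(S * S * (S * S)).trace.re * √(X * X).trace.re := by
  have h1 : (C * (S * X * S)).trace = ((S * C * S).conjTranspose * X).trace := by
    rw [Matrix.conjTranspose_mul, Matrix.conjTranspose_mul, hC.eq, hS.eq, ← Matrix.mul_assoc,
      Matrix.trace_mul_comm]
    simp only [Matrix.mul_assoc]
  have hK := norm_trace_conjTranspose_mul_le (S * C * S) X
  rw [← h1, hX.eq] at hK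
  refine (Complex.re_le_norm _).trans (hK.trans ?_)
  refine mul_le_mul_of_nonneg_right (Real.sqrt_le_sqrt ?_) (Real.sqrt_nonneg _)
  have h2 : ((S * C * S).conjTranspose * (S * C * S)).trace =
      ((S * S * C).conjTranspose * (C * (S * S))).trace := by
    simp only [Matrix.conjTranspose_mul, hC.eq, hS.eq, Matrix.mul_assoc]
    rw [Matrix.trace_mul_comm]
    simp only [Matrix.mul_assoc]
  have h3 := norm_trace_conjTranspose_mul_le (S * S * C) (C * (S * S))
  have h4 : ((S * S * C).conjTranspose * (S * S * C)).trace = (S * S * (S * S) * (C * C)).trace := by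
    simp only [Matrix.conjTranspose_mul, hC.eq, hS.eq, Matrix.mul_assoc]
    rw [Matrix.trace_mul_comm]
    simp only [Matrix.mul_assoc]
  have h5 : ((C * (S * S)).conjTranspose * (C * (S * S))).trace =
      (S * S * (S * S) * (C * C)).trace := by
    simp only [Matrix.conjTranspose_mul, hC.eq, hS.eq, Matrix.mul_assoc]
    rw [Matrix.trace_mul_comm, Matrix.mul_assoc, Matrix.trace_mul_comm]
    simp only [Matrix.mul_assoc]
    rw [Matrix.trace_mul_comm]
    simp only [Matrix.mul_assoc]
    rw [Matrix.trace_mul_comm]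
    simp only [Matrix.mul_assoc]
  have hS4 : (S * S * (S * S)).PosSemidef := by
    have := Matrix.posSemidef_conjTranspose_mul_self (S * S)
    rwa [Matrix.conjTranspose_mul, hS.eq] at this
  have h6 := trace_mul_nonneg hS4 hC1
  have h7 : 0 ≤ (S * S * (S * S) * (C * C)).trace.re := by
    refine trace_mul_nonneg hS4 ?_
    have := Matrix.posSemidef_conjTranspose_mul_self C
    rwa [hC.eq] at this
  rw [Matrix.mul_sub, Matrix.mul_one, Matrix.trace_sub, Complex.sub_re] at h6
  rw [h4, h5, Real.mul_self_sqrt h7] at h3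
  rw [h2]
  exact (Complex.re_le_norm _).trans (h3.trans (by linarith))

/-- The left side is `tr (G² ρ G²) ρ`; replacing the last `ρ` by its upper bound `lam S⁴` leaves
`lam tr ρ`. This is where the min-entropy enters. -/
theorem re_trace_sq_le {n : Type} [Fintype n] [DecidableEq n] {ρ S G : Matrix n n ℂ}
    (hρ : ρ.PosSemidef) (hG : G.IsHermitian) (hGS : G * S = 1) (hSG : S * G = 1) {lam : ℝ}
    (hle : ((lam : ℂ) • (S * S * (S * S)) - ρ).PosSemidef) :
    (G * ρ * G * (G * ρ * G)).trace.re ≤ lam * ρ.trace.re := by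
  have hpos : (G * G * ρ * (G * G)).PosSemidef := by
    have h := hρ.conjTranspose_mul_mul_same (G * G)
    rwa [Matrix.conjTranspose_mul, hG.eq] at h
  have h := trace_mul_nonneg hpos hle
  have e1 : (G * G * ρ * (G * G) * (S * S * (S * S))).trace = ρ.trace := by
    have : G * G * ρ * (G * G) * (S * S * (S * S)) = G * (G * (ρ * (G * (G * S) * S) * S) * S) := by
      simp only [Matrix.mul_assoc]
    rw [this, hGS, Matrix.mul_one, hGS, Matrix.mul_one, Matrix.trace_mul_comm]
    have : G * (ρ * S) * S * G = G * (ρ * S) * (S * G) := by simp only [Matrix.mul_assoc]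
    rw [this, hSG, Matrix.mul_one, Matrix.trace_mul_comm, Matrix.mul_assoc, hSG, Matrix.mul_one]
  have e2 : (G * G * ρ * (G * G) * ρ).trace = (G * ρ * G * (G * ρ * G)).trace := by
    rw [Matrix.mul_assoc, Matrix.mul_assoc G G, Matrix.mul_assoc G, Matrix.trace_mul_comm]
    simp only [Matrix.mul_assoc]
  rw [Matrix.mul_sub, Matrix.trace_sub, Matrix.mul_smul, Matrix.trace_smul, e1, e2, smul_eq_mul,
    Complex.sub_re, Complex.re_ofReal_mul] at h
  linarith

/-- The partial trace over the first system. -/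
def partialTraceFst {n R : Type} [Fintype n] (H : Matrix (n × R) (n × R) ℂ) : Matrix R R ℂ :=
  Matrix.of fun r s => ∑ x, H (x, r) (x, s)


theorem partialTraceFst_isHermitian {n R : Type} [Fintype n] {H : Matrix (n × R) (n × R) ℂ}
    (hH : H.IsHermitian) : (partialTraceFst H).IsHermitian := by
  ext r s
  simp only [partialTraceFst, Matrix.conjTranspose_apply, Matrix.of_apply, star_sum, hH.apply]

theorem partialTraceFst_mul_mul {n R : Type} [Fintype n] [DecidableEq n] [Fintype R]
    (s : Matrix R R ℂ) (H : Matrix (n × R) (n × R) ℂ) :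
    partialTraceFst (((1 : Matrix n n ℂ) ⊗ₖ s) * H * ((1 : Matrix n n ℂ) ⊗ₖ s)) =
      s * partialTraceFst H * s := by
  ext r t
  have h1 : ∀ (K : Matrix (n × R) (n × R) ℂ) x q, (K * ((1 : Matrix n n ℂ) ⊗ₖ s)) (x, r) (x, q) =
      ∑ p, K (x, r) (x, p) * s p q := by
    intro K x q
    simp [Matrix.mul_apply, Fintype.sum_prod_type, Matrix.one_apply]
  have h2 : ∀ x p, (((1 : Matrix n n ℂ) ⊗ₖ s) * H) (x, r) (x, p) =
      ∑ q, s r q * H (x, q) (x, p) := by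
    intro x p
    simp [Matrix.mul_apply, Fintype.sum_prod_type, Matrix.one_apply]
  simp only [partialTraceFst, Matrix.of_apply, h1, h2]
  simp only [Matrix.mul_apply, Matrix.of_apply, Finset.mul_sum, Finset.sum_mul]
  rw [Finset.sum_comm]
  refine Finset.sum_congr rfl fun p _ => Finset.sum_comm

/-- First moments follow from second ones: the trace of the rotated projection is the constant `L`,
so contracting the second factor gives `L` times the first moment. -/
theorem integral_rotated {n : Type} [Fintype n] [DecidableEq n] {E : Matrix n n ℂ} {L : ℕ}
    (hL0 : 0 < L) (hL : E.trace = L) {a b : ℝ}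
    (hab : (Fintype.card n : ℝ) ^ 2 * a + Fintype.card n * b = L ^ 2)
    (hm : ∀ i j k l, moment E i j k l =
        (if i = j ∧ k = l then (a : ℂ) else 0) + if i = l ∧ j = k then (b : ℂ) else 0) (i j : n) :
    ∫ U, rotated E U i j ∂(haarUnitary n) = if i = j then (L : ℂ) / Fintype.card n else 0 := by
  have hLc : (L : ℂ) ≠ 0 := by exact_mod_cast hL0.ne'
  have hn : (Fintype.card n : ℂ) ≠ 0 := by
    have : Nonempty n := ⟨i⟩
    exact_mod_cast Fintype.card_ne_zero
  have h := integral_sum_mul_rotated E (κ := n) (fun _ => 1) (fun _ => i) (fun _ => j)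
    (fun x => x) (fun x => x)
  have e : ∀ U, ∑ x, (1 : ℂ) * (rotated E U i j * rotated E U x x) = L * rotated E U i j := by
    intro U
    simp only [one_mul, ← Finset.mul_sum]
    rw [← hL, ← trace_rotated E U, mul_comm]
    rfl
  simp only [e] at h
  rw [integral_const_mul] at h
  simp only [hm, one_mul] at h
  have habc : (Fintype.card n : ℂ) ^ 2 * a + Fintype.card n * b = L ^ 2 := by exact_mod_cast hab
  refine mul_left_cancel₀ hLc (h.trans ?_)
  by_cases hij : i = j
  · subst hij
    have : ∀ x, (i = x ∧ i = x) ↔ i = x := fun x => and_self_iff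
    simp only [Finset.sum_add_distrib, this]
    simp
    field_simp
    linear_combination habc
  · have : ∀ x, ¬(i = x ∧ j = x) := fun x h => hij (h.1.trans h.2.symm)
    simp [hij, this]

/-- Alice's output and the reference after the application of `V`, minus its mean. -/
noncomputable def deviation {c n R : Type} [Fintype n] [Fintype R] [DecidableEq c] [DecidableEq R]
    (H : Matrix (n × R) (n × R) ℂ) (V : Matrix c n ℂ) : Matrix (c × R) (c × R) ℂ :=
  (V ⊗ₖ (1 : Matrix R R ℂ)) * H * (V ⊗ₖ (1 : Matrix R R ℂ)).conjTranspose -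
    (1 / Fintype.card n : ℂ) • ((1 : Matrix c c ℂ) ⊗ₖ partialTraceFst H)

theorem deviation_isHermitian {c n R : Type} [Fintype n] [Fintype R] [DecidableEq c]
    [DecidableEq R] {H : Matrix (n × R) (n × R) ℂ} (hH : H.IsHermitian) (V : Matrix c n ℂ) :
    (deviation H V).IsHermitian := by
  refine Matrix.IsHermitian.sub (Matrix.isHermitian_mul_mul_conjTranspose _ hH) ?_
  rw [Matrix.IsHermitian, Matrix.conjTranspose_smul, Matrix.conjTranspose_kronecker,
    (partialTraceFst_isHermitian hH).eq, Matrix.conjTranspose_one]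
  simp

/-- By cyclicity of the trace, `V` enters only through `V† V`, in a quadratic and a linear term. For
`V = Q U` this is a rotated projection, so averaging needs only its first two moments. -/
theorem trace_deviation_sq {c n R : Type} [Fintype c] [Fintype n] [Fintype R] [DecidableEq c]
    [DecidableEq n] [DecidableEq R] (H : Matrix (n × R) (n × R) ℂ) (V : Matrix c n ℂ)
    {W : Matrix n n ℂ} (hW : V.conjTranspose * V = W) :
    (deviation H V * deviation H V).trace =
      ∑ x : (n × n) × (n × n), (∑ r, ∑ s, H (x.1.2, r) (x.2.1, s) * H (x.2.2, s) (x.1.1, r)) *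
          (W x.1.1 x.1.2 * W x.2.1 x.2.2) -
        2 / Fintype.card n * ∑ x : n × n,
          (∑ r, ∑ s, H (x.2, r) (x.1, s) * partialTraceFst H s r) * W x.1 x.2 +
        Fintype.card c / (Fintype.card n) ^ 2 *
          (partialTraceFst H * partialTraceFst H).trace := by
  set Z := V ⊗ₖ (1 : Matrix R R ℂ) with hZ
  set T := partialTraceFst H with hT
  have hZZ : Z.conjTranspose * Z = W ⊗ₖ (1 : Matrix R R ℂ) := by
    rw [hZ, Matrix.conjTranspose_kronecker, ← Matrix.mul_kronecker_mul, hW,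
      Matrix.conjTranspose_one, Matrix.one_mul]
  have hcomm : (1 : Matrix c c ℂ) ⊗ₖ T * Z = Z * ((1 : Matrix n n ℂ) ⊗ₖ T) := by
    rw [hZ, ← Matrix.mul_kronecker_mul, ← Matrix.mul_kronecker_mul]
    simp
  have t1 : (Z * H * Z.conjTranspose * (Z * H * Z.conjTranspose)).trace =
      ((W ⊗ₖ (1 : Matrix R R ℂ)) * H * ((W ⊗ₖ (1 : Matrix R R ℂ)) * H)).trace := by
    calc _ = (Z * (H * Z.conjTranspose * Z * H * Z.conjTranspose)).trace := by
          simp only [Matrix.mul_assoc]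
      _ = (H * (Z.conjTranspose * Z * H * (Z.conjTranspose * Z))).trace := by
          rw [Matrix.trace_mul_comm]
          simp only [Matrix.mul_assoc]
      _ = _ := by
          rw [Matrix.trace_mul_comm, hZZ]
          simp only [Matrix.mul_assoc]
  have t2 : (Z * H * Z.conjTranspose * ((1 : Matrix c c ℂ) ⊗ₖ T)).trace =
      (((1 : Matrix n n ℂ) ⊗ₖ T) * H * (W ⊗ₖ (1 : Matrix R R ℂ))).trace := by
    rw [Matrix.trace_mul_comm, Matrix.mul_assoc Z, ← Matrix.mul_assoc _ Z, hcomm,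
      Matrix.mul_assoc Z, Matrix.trace_mul_comm, ← hZZ]
    simp only [Matrix.mul_assoc]
  have t3 : (((1 : Matrix c c ℂ) ⊗ₖ T) * ((1 : Matrix c c ℂ) ⊗ₖ T)).trace =
      Fintype.card c * (T * T).trace := by
    rw [← Matrix.mul_kronecker_mul, Matrix.trace_kronecker, Matrix.one_mul, Matrix.trace_one]
  have s1 : ((W ⊗ₖ (1 : Matrix R R ℂ)) * H * ((W ⊗ₖ (1 : Matrix R R ℂ)) * H)).trace =
      ∑ x : (n × n) × (n × n), (∑ r, ∑ s, H (x.1.2, r) (x.2.1, s) * H (x.2.2, s) (x.1.1, r)) *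
          (W x.1.1 x.1.2 * W x.2.1 x.2.2) := by
    have hent : ∀ i r p, ((W ⊗ₖ (1 : Matrix R R ℂ)) * H) (i, r) p = ∑ j, W i j * H (j, r) p := by
      intro i r p
      simp [Matrix.mul_apply, Fintype.sum_prod_type, Matrix.one_apply]
    have htr : ∀ K : Matrix (n × R) (n × R) ℂ, (K * K).trace = ∑ p, ∑ q, K p q * K q p :=
      fun _ => rfl
    rw [htr]
    calc _ = ∑ z : (n × R) × (n × R) × n × n, W z.1.1 z.2.2.1 * H (z.2.2.1, z.1.2) z.2.1 *
          (W z.2.1.1 z.2.2.2 * H (z.2.2.2, z.2.1.2) z.1) := by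
          simp only [Fintype.sum_prod_type, hent, Finset.sum_mul_sum]
      _ = ∑ w : ((n × n) × (n × n)) × R × R,
          H (w.1.1.2, w.2.1) (w.1.2.1, w.2.2) * H (w.1.2.2, w.2.2) (w.1.1.1, w.2.1) *
            (W w.1.1.1 w.1.1.2 * W w.1.2.1 w.1.2.2) :=
          Fintype.sum_equiv ⟨fun z => (((z.1.1, z.2.2.1), (z.2.1.1, z.2.2.2)), z.1.2, z.2.1.2),
            fun w => ((w.1.1.1, w.2.1), (w.1.2.1, w.2.2), w.1.1.2, w.1.2.2),
            fun _ => rfl, fun _ => rfl⟩ _ _ fun z => by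
              simp only [Equiv.coe_fn_mk]
              ring
      _ = _ := by
          rw [Fintype.sum_prod_type]
          refine Finset.sum_congr rfl fun x _ => ?_
          rw [Fintype.sum_prod_type]
          simp only [Finset.sum_mul]
  have s2 : (((1 : Matrix n n ℂ) ⊗ₖ T) * H * (W ⊗ₖ (1 : Matrix R R ℂ))).trace =
      ∑ x : n × n, (∑ r, ∑ s, H (x.2, r) (x.1, s) * T s r) * W x.1 x.2 := by
    have hent : ∀ x s p, (((1 : Matrix n n ℂ) ⊗ₖ T) * H) (x, s) p = ∑ r, T s r * H (x, r) p := by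
      intro x s p
      simp [Matrix.mul_apply, Fintype.sum_prod_type, Matrix.one_apply]
    have hdiag : ∀ (K : Matrix (n × R) (n × R) ℂ) x s,
        (K * (W ⊗ₖ (1 : Matrix R R ℂ))) (x, s) (x, s) = ∑ y, K (x, s) (y, s) * W y x := by
      intro K x s
      simp [Matrix.mul_apply, Fintype.sum_prod_type, Matrix.one_apply]
    calc _ = ∑ z : (n × R) × n × R, T z.1.2 z.2.2 * H (z.1.1, z.2.2) (z.2.1, z.1.2) *
          W z.2.1 z.1.1 := by
          simp only [Matrix.trace, Matrix.diag, Fintype.sum_prod_type, hdiag, hent, Finset.sum_mul]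
      _ = ∑ w : (n × n) × R × R, H (w.1.2, w.2.1) (w.1.1, w.2.2) * T w.2.2 w.2.1 *
          W w.1.1 w.1.2 :=
          Fintype.sum_equiv ⟨fun z => ((z.2.1, z.1.1), z.2.2, z.1.2),
            fun w => ((w.1.2, w.2.2), w.1.1, w.2.1), fun _ => rfl, fun _ => rfl⟩ _ _ fun z => by
              simp only [Equiv.coe_fn_mk]
              ring
      _ = _ := by
          rw [Fintype.sum_prod_type]
          refine Finset.sum_congr rfl fun x _ => ?_
          rw [Fintype.sum_prod_type]
          simp only [Finset.sum_mul]
  have hdev : deviation H V = Z * H * Z.conjTranspose -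
      (1 / Fintype.card n : ℂ) • ((1 : Matrix c c ℂ) ⊗ₖ T) := rfl
  rw [hdev, ← s1, ← s2, ← t1, ← t2, Matrix.mul_sub, Matrix.sub_mul, Matrix.sub_mul]
  simp only [Matrix.trace_sub, Matrix.smul_mul, Matrix.mul_smul, Matrix.trace_smul, smul_eq_mul,
    t3]
  rw [Matrix.trace_mul_comm (((1 : Matrix c c ℂ) ⊗ₖ T))]
  ring

theorem trace_mul_conjTranspose_nonneg {n : Type} [Fintype n] {X : Matrix n n ℂ}
    (hX : X.IsHermitian) : 0 ≤ (X * X).trace.re := by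
  have h := re_trace_mul_conjTranspose_self X
  rw [hX.eq] at h
  rw [h]
  positivity

theorem conjTranspose_mul_self_mul_unitary {c n : Type} [Fintype c] [Fintype n] [DecidableEq n]
    (Q : Matrix c n ℂ) (U : Matrix.unitaryGroup n ℂ) :
    (Q * (U : Matrix n n ℂ)).conjTranspose * (Q * (U : Matrix n n ℂ)) =
      rotated (Q.conjTranspose * Q) U := by
  rw [rotated, Matrix.conjTranspose_mul]
  simp only [Matrix.mul_assoc]

theorem continuous_trace_deviation_sq {c n R : Type} [Fintype c] [Fintype n] [Fintype R]
    [DecidableEq c] [DecidableEq n] [DecidableEq R] (H : Matrix (n × R) (n × R) ℂ)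
    (Q : Matrix c n ℂ) : Continuous fun U : Matrix.unitaryGroup n ℂ =>
      (deviation H (Q * (U : Matrix n n ℂ)) * deviation H (Q * (U : Matrix n n ℂ))).trace := by
  have hexp : ∀ U : Matrix.unitaryGroup n ℂ, _ := fun U =>
    trace_deviation_sq H (Q * (U : Matrix n n ℂ)) (conjTranspose_mul_self_mul_unitary Q U)
  simp only [hexp]
  have hc := continuous_rotated_apply (Q.conjTranspose * Q)
  exact ((continuous_finsetSum _ fun x _ => continuous_const.mul ((hc _ _).mul (hc _ _))).sub
    (continuous_const.mul (continuous_finsetSum _ fun x _ =>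
      continuous_const.mul (hc _ _)))).add continuous_const

/-- The second moment of the deviation for a Haar random unitary. -/
theorem integral_trace_deviation_sq_le {c n R : Type} [Fintype c] [Fintype n] [Fintype R]
    [DecidableEq c] [DecidableEq n] [DecidableEq R] [Nonempty c] {H : Matrix (n × R) (n × R) ℂ}
    (hH : H.IsHermitian) {Q : Matrix c n ℂ} (hQ : Q * Q.conjTranspose = 1) :
    ∫ U : Matrix.unitaryGroup n ℂ,
        (deviation H (Q * (U : Matrix n n ℂ)) * deviation H (Q * (U : Matrix n n ℂ))).trace.re
        ∂(haarUnitary n) ≤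
      ((Fintype.card c : ℝ) / Fintype.card n) ^ 2 * (H * H).trace.re := by
  set E := Q.conjTranspose * Q with hE
  set L := Fintype.card c with hLdef
  have hL0 : 0 < L := Fintype.card_pos
  have hEp : E.PosSemidef := Matrix.posSemidef_conjTranspose_mul_self Q
  have hEE : E * E = E := by
    rw [hE, Matrix.mul_assoc, ← Matrix.mul_assoc Q, hQ, Matrix.one_mul]
  have hL : E.trace = L := by
    rw [hE, Matrix.trace_mul_comm, hQ, Matrix.trace_one]
  obtain ⟨a, b, ha, hb, hab, hba, hm⟩ := exists_moment_projection hEp hEE hL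
  have hn : (0 : ℝ) < Fintype.card n := by
    rcases isEmpty_or_nonempty n with h | h
    · have : E.trace = 0 := by simp [Matrix.trace]
      rw [hL] at this
      exact absurd (by exact_mod_cast this) hL0.ne'
    · exact_mod_cast Fintype.card_pos
  have hnc : (Fintype.card n : ℂ) ≠ 0 := by exact_mod_cast hn.ne'
  set T := partialTraceFst H with hT
  have hTT := trace_mul_conjTranspose_nonneg (partialTraceFst_isHermitian hH)
  have hHH := trace_mul_conjTranspose_nonneg hH
  rw [← hT] at hTT
  have hint : ∫ U : Matrix.unitaryGroup n ℂ,
        (deviation H (Q * (U : Matrix n n ℂ)) * deviation H (Q * (U : Matrix n n ℂ))).trace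
        ∂(haarUnitary n) =
      a * (H * H).trace + (b - L / (Fintype.card n : ℂ) ^ 2) * (T * T).trace := by
    have hexp : ∀ U : Matrix.unitaryGroup n ℂ, _ := fun U =>
      trace_deviation_sq H (Q * (U : Matrix n n ℂ)) (conjTranspose_mul_self_mul_unitary Q U)
    simp only [hexp]
    have i1 : Integrable (fun U => ∑ x : (n × n) × (n × n),
        (∑ r, ∑ s, H (x.1.2, r) (x.2.1, s) * H (x.2.2, s) (x.1.1, r)) *
          (rotated E U x.1.1 x.1.2 * rotated E U x.2.1 x.2.2)) (haarUnitary n) :=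
      integrable_finsetSum _ fun x _ => (integrable_rotated_mul E _ _ _ _).const_mul _
    have i2 : Integrable (fun U => ∑ x : n × n,
        (∑ r, ∑ s, H (x.2, r) (x.1, s) * T s r) * rotated E U x.1 x.2) (haarUnitary n) :=
      integrable_finsetSum _ fun x _ => (integrable_haarUnitary_of_continuous
        (continuous_rotated_apply E _ _)).const_mul _
    have lin : ∀ (f g : Matrix.unitaryGroup n ℂ → ℂ) (k z : ℂ), Integrable f (haarUnitary n) →
        Integrable g (haarUnitary n) → ∫ U, (f U - k * g U + z) ∂(haarUnitary n) =
          ∫ U, f U ∂(haarUnitary n) - k * ∫ U, g U ∂(haarUnitary n) + z := by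
      intro f g k z hf hg
      have h1 := integral_add (hf.sub (hg.const_mul k)) (integrable_const z)
      have h2 := integral_sub hf (hg.const_mul k)
      simp only [Pi.sub_apply] at h1
      rw [h1, h2, integral_const_mul, integral_const, probReal_univ, one_smul]
    refine (lin _ _ _ _ i1 i2).trans ?_
    rw [integral_sum_mul_rotated E
        (fun x : (n × n) × (n × n) =>
          ∑ r, ∑ s, H (x.1.2, r) (x.2.1, s) * H (x.2.2, s) (x.1.1, r))
        (fun x => x.1.1) (fun x => x.1.2) (fun x => x.2.1) (fun x => x.2.2),
      integral_finsetSum _ fun x _ => (integrable_haarUnitary_of_continuous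
        (continuous_rotated_apply E _ _)).const_mul _]
    simp only [integral_const_mul, integral_rotated hL0 hL hab hm, hm]
    have e1 : ∑ x : (n × n) × (n × n),
        (∑ r, ∑ s, H (x.1.2, r) (x.2.1, s) * H (x.2.2, s) (x.1.1, r)) *
          ((if x.1.1 = x.1.2 ∧ x.2.1 = x.2.2 then (a : ℂ) else 0) +
            if x.1.1 = x.2.2 ∧ x.1.2 = x.2.1 then (b : ℂ) else 0) =
        a * (H * H).trace + b * (T * T).trace := by
      simp only [mul_add, Finset.sum_add_distrib]
      congr 1
      · simp only [Fintype.sum_prod_type, ite_and, mul_ite, mul_zero, Finset.sum_ite_eq,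
          Finset.mem_univ, if_true, Finset.sum_ite_irrel, Finset.sum_const_zero]
        simp only [← Finset.sum_mul]
        rw [mul_comm]
        congr 1
        simp only [Matrix.trace, Matrix.diag, Matrix.mul_apply, Fintype.sum_prod_type]
        exact Finset.sum_congr rfl fun i _ => Finset.sum_comm
      · have : ∀ i j k l : n, (if i = l ∧ j = k then (b : ℂ) else 0) =
            if l = i then (if k = j then (b : ℂ) else 0) else 0 := by
          intro i j k l
          by_cases h1 : l = i
          · by_cases h2 : k = j
            · simp [h1, h2]
            · simp [h2, Ne.symm h2]
          · simp [h1, Ne.symm h1]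
        simp only [this, Fintype.sum_prod_type, mul_ite, mul_zero, Finset.sum_ite_eq',
          Finset.mem_univ, if_true]
        simp only [← Finset.sum_mul]
        rw [mul_comm]
        congr 1
        calc _ = ∑ z : (n × n) × R × R, H (z.1.2, z.2.1) (z.1.2, z.2.2) *
              H (z.1.1, z.2.2) (z.1.1, z.2.1) := by
              simp only [Fintype.sum_prod_type]
          _ = ∑ z : (R × R) × n × n, H (z.2.1, z.1.1) (z.2.1, z.1.2) *
              H (z.2.2, z.1.2) (z.2.2, z.1.1) :=
              Fintype.sum_equiv ⟨fun z => (z.2, z.1.2, z.1.1), fun z => ((z.2.2, z.2.1), z.1),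
                fun _ => rfl, fun _ => rfl⟩ _ _ fun z => rfl
          _ = _ := by
              simp only [Matrix.trace, Matrix.diag, Matrix.mul_apply, Fintype.sum_prod_type, hT,
                partialTraceFst, Matrix.of_apply, Finset.sum_mul_sum]
    have e2 : ∑ x : n × n, (∑ r, ∑ s, H (x.2, r) (x.1, s) * T s r) *
        (if x.1 = x.2 then (L : ℂ) / Fintype.card n else 0) =
        L / Fintype.card n * (T * T).trace := by
      simp only [Fintype.sum_prod_type, mul_ite, mul_zero, Finset.sum_ite_eq, Finset.mem_univ,
        if_true]
      rw [← Finset.sum_mul, mul_comm]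
      congr 1
      calc _ = ∑ z : n × R × R, H (z.1, z.2.1) (z.1, z.2.2) * T z.2.2 z.2.1 := by
            simp only [Fintype.sum_prod_type]
        _ = ∑ z : (R × R) × n, H (z.2, z.1.1) (z.2, z.1.2) * T z.1.2 z.1.1 :=
            Fintype.sum_equiv ⟨fun z => (z.2, z.1), fun z => (z.2, z.1),
              fun _ => rfl, fun _ => rfl⟩ _ _ fun z => rfl
        _ = ∑ r, ∑ s, T r s * T s r := by
            simp only [Fintype.sum_prod_type, ← Finset.sum_mul]
            rfl
    rw [e1, e2]
    field_simp
    ring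
  have hcont := continuous_trace_deviation_sq H Q
  have hre : ∫ U : Matrix.unitaryGroup n ℂ,
        (deviation H (Q * (U : Matrix n n ℂ)) * deviation H (Q * (U : Matrix n n ℂ))).trace.re
        ∂(haarUnitary n) = (a * (H * H).trace +
          (b - L / (Fintype.card n : ℂ) ^ 2) * (T * T).trace).re := by
    rw [← hint]
    exact integral_re (𝕜 := ℂ) (integrable_haarUnitary_of_continuous hcont)
  have hval : (a * (H * H).trace + (b - L / (Fintype.card n : ℂ) ^ 2) * (T * T).trace).re =
      a * (H * H).trace.re + (b - L / (Fintype.card n : ℝ) ^ 2) * (T * T).trace.re := by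
    have : (b - L / (Fintype.card n : ℂ) ^ 2) = ((b - L / (Fintype.card n : ℝ) ^ 2 : ℝ) : ℂ) := by
      push_cast
      rfl
    rw [this, Complex.add_re, Complex.re_ofReal_mul, Complex.re_ofReal_mul]
  rw [hre, hval]
  -- Nonnegativity of `a` and `b` in the two trace equations is enough. The bound on `b` makes the
  -- coefficient of `tr T²` nonpositive, so that term is discarded.
  have ha' : a ≤ ((L : ℝ) / Fintype.card n) ^ 2 := by
    rw [div_pow, le_div_iff₀ (by positivity)]
    nlinarith
  have hb' : b ≤ L / (Fintype.card n : ℝ) ^ 2 := by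
    rw [le_div_iff₀ (by positivity)]
    nlinarith
  have := mul_le_mul_of_nonneg_right ha' hHH
  have := mul_nonneg (sub_nonneg.mpr hb') hTT
  linarith

/-- Jensen's inequality. It serves twice: from the mean squared deviation to the mean deviation, and
from that to the mean error. -/
theorem integral_sqrt_le {α : Type} [MeasurableSpace α] {μ : Measure α} [IsProbabilityMeasure μ]
    {f : α → ℝ} (hf : Integrable f μ) (hs : Integrable (fun x => √(f x)) μ) (h0 : ∀ x, 0 ≤ f x) :
    ∫ x, √(f x) ∂μ ≤ √(∫ x, f x ∂μ) :=
  Real.strictConcaveOn_sqrt.concaveOn.le_map_integral Real.continuous_sqrt.continuousOn isClosed_Ici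
    (Filter.Eventually.of_forall h0) hf hs

theorem exists_posDef_root {R : Type} [Fintype R] [DecidableEq R] {σ : Matrix R R ℂ}
    (hσ : σ.PosDef) : ∃ s g : Matrix R R ℂ, s.IsHermitian ∧ g.IsHermitian ∧ g * s = 1 ∧
      s * g = 1 ∧ s * s * (s * s) = σ := by
  have hσ' : IsStrictlyPositive σ := Matrix.isStrictlyPositive_iff_posDef.mpr hσ
  have h2 : IsStrictlyPositive (CFC.sqrt (CFC.sqrt σ)) := (hσ'.sqrt).sqrt
  have hs : (CFC.sqrt (CFC.sqrt σ)).PosDef := Matrix.isStrictlyPositive_iff_posDef.mp h2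
  have hu : IsUnit (CFC.sqrt (CFC.sqrt σ)).det := (Matrix.isUnit_iff_isUnit_det _).mp hs.isUnit
  refine ⟨CFC.sqrt (CFC.sqrt σ), (CFC.sqrt (CFC.sqrt σ))⁻¹, hs.1, hs.inv.1,
    Matrix.nonsing_inv_mul _ hu, Matrix.mul_nonsing_inv _ hu, ?_⟩
  rw [CFC.sqrt_mul_sqrt_self _ (CFC.sqrt_nonneg _), CFC.sqrt_mul_sqrt_self _ hσ'.nonneg]

/-- The decoupling theorem. -/
theorem decoupling {c n R : Type} [Fintype c] [Fintype n] [Fintype R] [DecidableEq c]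
    [DecidableEq n] [DecidableEq R] [Nonempty c] {ρ : Matrix (n × R) (n × R) ℂ}
    (hρ : ρ.PosSemidef) (hρ1 : ρ.trace.re = 1) {σ : Matrix R R ℂ} (hσ : σ.PosDef) (hσ1 : σ.trace = 1)
    {lam : ℝ} (hle : ((lam : ℂ) • ((1 : Matrix n n ℂ) ⊗ₖ σ) - ρ).PosSemidef) {Q : Matrix c n ℂ}
    (hQ : Q * Q.conjTranspose = 1) :
    ∃ e : Matrix.unitaryGroup n ℂ → ℝ, Continuous e ∧ (∀ U, 0 ≤ e U) ∧
      ∫ U, e U ∂(haarUnitary n) ≤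
        (Fintype.card c : ℝ) / Fintype.card n * √(Fintype.card c * lam) ∧
      ∀ (U : Matrix.unitaryGroup n ℂ) (C : Matrix (c × R) (c × R) ℂ), C.IsHermitian →
        (1 - C * C).PosSemidef → (C * deviation ρ (Q * (U : Matrix n n ℂ))).trace.re ≤ e U := by
  obtain ⟨s, g, hs, hg, hgs, hsg, hs4⟩ := exists_posDef_root hσ
  set G := (1 : Matrix n n ℂ) ⊗ₖ g with hG
  set S := (1 : Matrix n n ℂ) ⊗ₖ s with hS
  set H := G * ρ * G with hH
  have hGH : G.IsHermitian := by
    rw [Matrix.IsHermitian, hG, Matrix.conjTranspose_kronecker, hg.eq, Matrix.conjTranspose_one]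
  have hHH : H.IsHermitian := by
    have := Matrix.isHermitian_mul_mul_conjTranspose G hρ.1
    rwa [hGH.eq] at this
  have hGS : G * S = 1 := by
    rw [hG, hS, ← Matrix.mul_kronecker_mul, hgs, Matrix.one_mul, Matrix.one_kronecker_one]
  have hSG : S * G = 1 := by
    rw [hG, hS, ← Matrix.mul_kronecker_mul, hsg, Matrix.one_mul, Matrix.one_kronecker_one]
  have hS4 : S * S * (S * S) = (1 : Matrix n n ℂ) ⊗ₖ σ := by
    simp only [hS, ← Matrix.mul_kronecker_mul, Matrix.one_mul, hs4]
  have htr : (H * H).trace.re ≤ lam := by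
    have := re_trace_sq_le hρ hGH hGS hSG (lam := lam) (by rwa [hS4])
    rwa [hρ1, mul_one] at this
  set S' := (1 : Matrix c c ℂ) ⊗ₖ s with hS'
  have hSH' : S'.IsHermitian := by
    rw [Matrix.IsHermitian, hS', Matrix.conjTranspose_kronecker, hs.eq, Matrix.conjTranspose_one]
  have hS4' : (S' * S' * (S' * S')).trace.re = Fintype.card c := by
    simp only [hS', ← Matrix.mul_kronecker_mul, hs4, Matrix.trace_kronecker,
      Matrix.trace_one, hσ1, mul_one, Complex.natCast_re]
  have hρH : ρ = S * H * S := by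
    have : S * H * S = (S * G) * ρ * (G * S) := by simp only [hH, Matrix.mul_assoc]
    rw [this, hSG, hGS, Matrix.one_mul, Matrix.mul_one]
  -- Weights on `R` commute with Alice's operators and pass through the partial trace, so the
  -- second-moment estimate can be applied to `H` instead of `ρ`.
  have hdev : ∀ V : Matrix c n ℂ, deviation ρ V = S' * deviation H V * S' := by
    intro V
    have hV : (V ⊗ₖ (1 : Matrix R R ℂ)) * S = S' * (V ⊗ₖ (1 : Matrix R R ℂ)) := by
      rw [hS, hS', ← Matrix.mul_kronecker_mul, ← Matrix.mul_kronecker_mul]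
      simp
    have hSH : S.IsHermitian := by
      rw [Matrix.IsHermitian, hS, Matrix.conjTranspose_kronecker, hs.eq, Matrix.conjTranspose_one]
    have hV' : S * (V ⊗ₖ (1 : Matrix R R ℂ)).conjTranspose =
        (V ⊗ₖ (1 : Matrix R R ℂ)).conjTranspose * S' := by
      have := congrArg Matrix.conjTranspose hV
      rwa [Matrix.conjTranspose_mul, Matrix.conjTranspose_mul, hSH.eq, hSH'.eq] at this
    have hpt : partialTraceFst ρ = s * partialTraceFst H * s := by
      conv_lhs => rw [hρH]
      exact partialTraceFst_mul_mul s H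
    rw [deviation, deviation, Matrix.mul_sub, Matrix.sub_mul, hpt]
    congr 1
    · conv_lhs => rw [hρH]
      calc _ = (V ⊗ₖ (1 : Matrix R R ℂ)) * S * H * (S * (V ⊗ₖ (1 : Matrix R R ℂ)).conjTranspose) := by
            simp only [Matrix.mul_assoc]
        _ = _ := by
            rw [hV, hV']
            simp only [Matrix.mul_assoc]
    · rw [Matrix.mul_smul, Matrix.smul_mul, hS', ← Matrix.mul_kronecker_mul,
        ← Matrix.mul_kronecker_mul, Matrix.one_mul, Matrix.one_mul]
  set f : Matrix.unitaryGroup n ℂ → ℝ := fun U =>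
    (deviation H (Q * (U : Matrix n n ℂ)) * deviation H (Q * (U : Matrix n n ℂ))).trace.re with hf
  have hfc : Continuous f := Complex.continuous_re.comp (continuous_trace_deviation_sq H Q)
  have hf0 : ∀ U, 0 ≤ f U := fun U => trace_mul_conjTranspose_nonneg (deviation_isHermitian hHH _)
  refine ⟨fun U => √(Fintype.card c) * √(f U), continuous_const.mul hfc.sqrt,
    fun U => by positivity, ?_, fun U C hC hC1 => ?_⟩
  · rw [integral_const_mul]
    have h1 := integral_sqrt_le (integrable_haarUnitary_of_continuous hfc)
      (integrable_haarUnitary_of_continuous hfc.sqrt) hf0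
    have h2 : ∫ U, f U ∂(haarUnitary n) ≤ ((Fintype.card c : ℝ) / Fintype.card n) ^ 2 * lam :=
      (integral_trace_deviation_sq_le hHH hQ).trans (by gcongr)
    calc √(Fintype.card c : ℝ) * ∫ U, √(f U) ∂(haarUnitary n)
        ≤ √(Fintype.card c : ℝ) * √(((Fintype.card c : ℝ) / Fintype.card n) ^ 2 * lam) := by
          gcongr
          exact h1.trans (Real.sqrt_le_sqrt h2)
      _ = _ := by
          rw [Real.sqrt_mul (by positivity), Real.sqrt_sq (by positivity),
            Real.sqrt_mul (by positivity)]
          ring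
  · have h := re_trace_mul_weighted_le hC hC1 hSH'
      (deviation_isHermitian hHH (Q * (U : Matrix n n ℂ)))
    rw [hS4', ← hdev] at h
    exact h

/-! ### Conditional min-entropy: a nearly optimal invertible state -/

open scoped Matrix.Norms.L2Operator in
theorem exists_smul_one_sub_posSemidef {n : Type} [Fintype n] [DecidableEq n] {ρ : Matrix n n ℂ}
    (hρ : ρ.IsHermitian) : ∃ t : ℝ, ((t : ℂ) • (1 : Matrix n n ℂ) - ρ).PosSemidef := by
  have h := IsSelfAdjoint.le_algebraMap_norm_self (a := ρ) hρ
  refine ⟨‖ρ‖, ?_⟩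
  rw [Matrix.le_iff] at h
  have e : algebraMap ℝ (Matrix n n ℂ) ‖ρ‖ = ((‖ρ‖ : ℝ) : ℂ) • (1 : Matrix n n ℂ) := by
    rw [Algebra.algebraMap_eq_smul_one]
    ext i j
    simp [Matrix.smul_apply]
  rwa [e] at h

section MinEntropy

variable {A R : Type} [Fintype A] [Fintype R] [DecidableEq A]

/-- Take traces. This keeps admissible `lam` away from zero, and later handles `L > |A| K`. -/
theorem one_le_mul_card {ρ : Matrix (A × R) (A × R) ℂ} (hρ1 : ρ.trace.re = 1) {σ : Matrix R R ℂ}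
    (hσ1 : σ.trace = 1) {lam : ℝ}
    (h : ((lam : ℂ) • ((1 : Matrix A A ℂ) ⊗ₖ σ) - ρ).PosSemidef) :
    1 ≤ lam * Fintype.card A := by
  have h0 := (Complex.le_def.mp h.trace_nonneg).1
  rw [Matrix.trace_sub, Matrix.trace_smul, Matrix.trace_kronecker, Matrix.trace_one, hσ1, mul_one,
    smul_eq_mul, Complex.sub_re, hρ1, Complex.re_ofReal_mul, Complex.natCast_re,
    Complex.zero_re] at h0
  linarith

variable [DecidableEq R]

/-- The admissible values form a closed nonempty set that is bounded below. This is needed only for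
the maximally mixed state, to show that the supremum defining the min-entropy is over a nonempty
set. -/
theorem exists_isMinLambda {ρ : Matrix (A × R) (A × R) ℂ} (hρ : ρ.IsHermitian)
    (hρ1 : ρ.trace.re = 1) {σ : Matrix R R ℂ} {r : ℝ} (hr : 0 < r) (hσr : σ = ((1 / r : ℝ) : ℂ) • 1)
    (hσ1 : σ.trace = 1) :
    ∃ lam : ℝ, IsMinLambda ρ σ lam := by
  have hA : 0 < (Fintype.card A : ℝ) := by
    rcases isEmpty_or_nonempty A with h | h
    · simp [Matrix.trace] at hρ1
    · exact_mod_cast Fintype.card_pos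
  have hK : (1 : Matrix A A ℂ) ⊗ₖ σ = ((1 / r : ℝ) : ℂ) • 1 := by
    rw [hσr, Matrix.kronecker_smul, Matrix.one_kronecker_one]
  have hH : ∀ l : ℝ, ((l : ℂ) • ((1 : Matrix A A ℂ) ⊗ₖ σ) - ρ).IsHermitian := by
    intro l
    refine Matrix.IsHermitian.sub ?_ hρ
    rw [Matrix.IsHermitian, Matrix.conjTranspose_smul, hK, Matrix.conjTranspose_smul]
    simp
  set s := {l : ℝ | ((l : ℂ) • ((1 : Matrix A A ℂ) ⊗ₖ σ) - ρ).PosSemidef} with hs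
  have hclosed : IsClosed s := by
    have : s = ⋂ v : A × R → ℂ,
        {l : ℝ | 0 ≤ (star v ⬝ᵥ ((l : ℂ) • ((1 : Matrix A A ℂ) ⊗ₖ σ) - ρ).mulVec v)} := by
      ext l
      simp only [hs, Set.mem_ofPred_eq, Set.mem_iInter, Matrix.posSemidef_iff_dotProduct_mulVec]
      exact ⟨fun h => h.2, fun h => ⟨hH l, h⟩⟩
    rw [this]
    refine isClosed_iInter fun v => isClosed_le continuous_const ?_
    simp only [Matrix.sub_mulVec, Matrix.smul_mulVec, dotProduct_sub, dotProduct_smul, smul_eq_mul]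
    fun_prop
  have hbdd : BddBelow s := ⟨0, fun l hl => by
    have := one_le_mul_card hρ1 hσ1 hl
    by_contra hneg
    nlinarith⟩
  have hne : s.Nonempty := by
    obtain ⟨t, ht⟩ := exists_smul_one_sub_posSemidef hρ
    refine ⟨r * t, ?_⟩
    simp only [hs, Set.mem_ofPred_eq]
    rw [hK, smul_smul, ← Complex.ofReal_mul, show r * t * (1 / r) = t by field_simp]
    exact ht
  exact ⟨sInf s, hclosed.isLeast_csInf hne hbdd⟩

/-- A positive definite state that is nearly optimal for the conditional min-entropy. -/
theorem exists_posDef_near_condMinEntropy {ρ : Matrix (A × R) (A × R) ℂ} (hρ : ρ.PosSemidef)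
    (hρ1 : ρ.trace.re = 1) :
    ∃ (σ : Matrix R R ℂ) (lam : ℝ), σ.PosDef ∧ σ.trace = 1 ∧
      ((lam : ℂ) • ((1 : Matrix A A ℂ) ⊗ₖ σ) - ρ).PosSemidef ∧
      lam ≤ 4 * (2 : ℝ) ^ (-condMinEntropy ρ) := by
  have hR : Nonempty R := by
    by_contra h
    rw [not_nonempty_iff] at h
    simp [Matrix.trace] at hρ1
  have hcR : (0 : ℝ) < Fintype.card R := by exact_mod_cast Fintype.card_pos
  have hcRc : (Fintype.card R : ℂ) ≠ 0 := by exact_mod_cast hcR.ne'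
  set τ : Matrix R R ℂ := (1 / Fintype.card R : ℂ) • 1 with hτ
  have hτp : τ.PosDef := by
    refine Matrix.PosDef.one.smul ?_
    have : (1 / Fintype.card R : ℂ) = ((1 / Fintype.card R : ℝ) : ℂ) := by push_cast; rfl
    rw [this]
    exact_mod_cast (by positivity : (0 : ℝ) < 1 / Fintype.card R)
  have hτ1 : τ.trace = 1 := by
    rw [hτ, Matrix.trace_smul, Matrix.trace_one, smul_eq_mul, one_div, inv_mul_cancel₀ hcRc]
  set s := {h : ℝ | ∃ (σ : Matrix R R ℂ) (lam : ℝ),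
    IsDensity σ ∧ IsMinLambda ρ σ lam ∧ h = -Real.logb 2 lam} with hs
  have hne : s.Nonempty := by
    obtain ⟨lam, hlam⟩ := exists_isMinLambda hρ.1 hρ1 hcR (by
      rw [hτ]; push_cast; rfl) hτ1
    exact ⟨_, τ, lam, ⟨hτp.posSemidef, hτ1⟩, hlam, rfl⟩
  -- Being within one bit of the supremum costs a factor 2 in `lam`.
  obtain ⟨h, ⟨σ, lam, ⟨hσ, hσ1⟩, hlam, rfl⟩, hlt⟩ :=
    exists_lt_of_lt_csSup hne (sub_one_lt (sSup s))
  have hmem : ((lam : ℂ) • ((1 : Matrix A A ℂ) ⊗ₖ σ) - ρ).PosSemidef := hlam.1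
  have hpos : 0 < lam := by
    have := one_le_mul_card hρ1 hσ1 hmem
    by_contra hneg
    have hA : 0 ≤ (Fintype.card A : ℝ) := by positivity
    nlinarith
  have hle : lam ≤ 2 * (2 : ℝ) ^ (-condMinEntropy ρ) := by
    have h1 : Real.logb 2 lam ≤ 1 + -condMinEntropy ρ := by
      have : sSup s = condMinEntropy ρ := rfl
      linarith
    calc lam = (2 : ℝ) ^ Real.logb 2 lam := (Real.rpow_logb (by norm_num) (by norm_num) hpos).symm
      _ ≤ (2 : ℝ) ^ (1 + -condMinEntropy ρ) := Real.rpow_le_rpow_of_exponent_le (by norm_num) h1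
      _ = _ := by rw [Real.rpow_add (by norm_num), Real.rpow_one]
  have hhalf : (0 : ℂ) < 1 / 2 := by
    have : (1 / 2 : ℂ) = ((1 / 2 : ℝ) : ℂ) := by push_cast; rfl
    rw [this]
    exact_mod_cast (by norm_num : (0 : ℝ) < 1 / 2)
  -- Mixing with the maximally mixed state makes `σ` invertible and costs another factor 2. The new
  -- value need not be minimal; only the operator inequality is used.
  refine ⟨(1 / 2 : ℂ) • (σ + τ), 2 * lam, (hτp.posSemidef_add hσ).smul hhalf, ?_, ?_, by linarith⟩
  · rw [Matrix.trace_smul, Matrix.trace_add, hσ1, hτ1]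
    norm_num
  · have h2 := hmem.add ((Matrix.PosSemidef.one (n := A) (R := ℂ)).kronecker hτp.posSemidef |>.smul
      (show (0 : ℂ) ≤ lam by exact_mod_cast hpos.le))
    convert h2 using 1
    rw [Matrix.kronecker_smul, Matrix.kronecker_add, smul_smul, smul_add]
    push_cast
    rw [show (2 * lam * (1 / 2) : ℂ) = lam by ring]
    abel

end MinEntropy

/-! ### Reduced operators of the initial and target vectors -/

theorem trace_partialTraceFst {n R : Type} [Fintype n] [Fintype R]
    (H : Matrix (n × R) (n × R) ℂ) : (partialTraceFst H).trace = H.trace := by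
  simp only [Matrix.trace, Matrix.diag, partialTraceFst, Matrix.of_apply, Fintype.sum_prod_type]
  exact Finset.sum_comm

section InitialState

theorem branch_eq_mul {a b c R : Type} [Fintype a] [Fintype R] [DecidableEq R] (P : Matrix c a ℂ)
    (φ : (a × b) × R → ℂ) :
    branch P φ = (P ⊗ₖ (1 : Matrix R R ℂ)) * asMatrix φ := by
  ext p y
  simp [branch, asMatrix, Matrix.mul_apply, Fintype.sum_prod_type, Matrix.one_apply]

theorem maxEntangled_sum {K : ℕ} (k k' : Fin K) :
    ∑ x, maxEntangled K k x * star (maxEntangled K k' x) = if k = k' then (1 / K : ℂ) else 0 := by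
  have h : (((√(K : ℝ))⁻¹ : ℝ) : ℂ) * (((√(K : ℝ))⁻¹ : ℝ) : ℂ) = (K : ℂ)⁻¹ := by
    rw [← Complex.ofReal_mul, ← mul_inv, Real.mul_self_sqrt (by positivity)]
    push_cast
    rfl
  by_cases hk : k = k'
  · subst hk
    simpa [maxEntangled] using h
  · simp [maxEntangled, hk, Ne.symm hk]

variable {A B R : Type} [Fintype B]

theorem reduced_initialVec_apply (ψ : (A × B) × R → ℂ) (K : ℕ) (p q : (A × Fin K) × R) :
    (asMatrix (initialVec ψ K) * (asMatrix (initialVec ψ K)).conjTranspose) p q =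
      (if p.1.2 = q.1.2 then (1 / K : ℂ) else 0) *
        partialTraceB (pureState ψ) (p.1.1, p.2) (q.1.1, q.2) := by
  rw [← maxEntangled_sum]
  simp only [Matrix.mul_apply, asMatrix, initialVec, Matrix.conjTranspose_apply, Matrix.of_apply,
    partialTraceB, pureState, Matrix.vecMulVec_apply, Pi.star_apply, Fintype.sum_prod_type_right,
    Finset.sum_mul_sum, star_mul']
  refine Finset.sum_congr rfl fun k _ => Finset.sum_congr rfl fun b _ => by ring

theorem partialTraceB_pureState (ψ : (A × B) × R → ℂ) :
    partialTraceB (pureState ψ) =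
      asMatrix (fun p : (A × B) × R => ψ p) * (asMatrix (fun p : (A × B) × R => ψ p)).conjTranspose := by
  ext p q
  simp [partialTraceB, pureState, Matrix.vecMulVec_apply, asMatrix, Matrix.mul_apply]

variable [Fintype A]

theorem partialTraceFst_reduced_initialVec (ψ : (A × B) × R → ℂ) {K : ℕ} (hK : 0 < K) :
    partialTraceFst (asMatrix (initialVec ψ K) * (asMatrix (initialVec ψ K)).conjTranspose) =
      partialTraceFst (partialTraceB (pureState ψ)) := by
  have hKc : (K : ℂ) ≠ 0 := by exact_mod_cast hK.ne'
  ext r s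
  simp only [partialTraceFst, Matrix.of_apply, reduced_initialVec_apply, Fintype.sum_prod_type]
  simp [hKc]

/-- Tracing out `B₁` turns `Φ_L` into `id/L`. Thus the mean subtracted in `deviation` is a multiple
of the target's reduced operator. -/
theorem reduced_targetVec (ψ : (A × B) × R → ℂ) {L : ℕ} (hL : 0 < L) :
    (L : ℂ) • (asMatrix (targetVec ψ L) * (asMatrix (targetVec ψ L)).conjTranspose) =
      (1 : Matrix (Fin L) (Fin L) ℂ) ⊗ₖ partialTraceFst (partialTraceB (pureState ψ)) := by
  have hLc : (L : ℂ) ≠ 0 := by exact_mod_cast hL.ne'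
  ext p q
  have h : (asMatrix (targetVec ψ L) * (asMatrix (targetVec ψ L)).conjTranspose) p q =
      (∑ x, maxEntangled L p.1 x * star (maxEntangled L q.1 x)) *
        partialTraceFst (partialTraceB (pureState ψ)) p.2 q.2 := by
    simp only [Matrix.mul_apply, asMatrix, targetVec, Matrix.conjTranspose_apply, Matrix.of_apply,
      partialTraceB, pureState, Matrix.vecMulVec_apply, Pi.star_apply, Fintype.sum_prod_type,
      star_mul', partialTraceFst]
    rw [Finset.sum_mul]
    refine Finset.sum_congr rfl fun k _ => ?_
    rw [Finset.mul_sum]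
    refine Finset.sum_congr rfl fun a _ => ?_
    rw [Finset.mul_sum]
    exact Finset.sum_congr rfl fun b _ => by ring
  rw [Matrix.smul_apply, h, maxEntangled_sum, Matrix.kroneckerMap_apply, Matrix.one_apply]
  by_cases hpq : p.1 = q.1 <;> simp [hpq, hLc]

variable [Fintype R]

theorem posSemidef_partialTraceB (ψ : (A × B) × R → ℂ) :
    (partialTraceB (pureState ψ)).PosSemidef := by
  rw [partialTraceB_pureState]
  exact Matrix.posSemidef_self_mul_conjTranspose _

theorem trace_partialTraceB (ψ : (A × B) × R → ℂ) :
    (partialTraceB (pureState ψ)).trace.re = normSqVec ψ := by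
  rw [partialTraceB_pureState, asMatrix_mul_conjTranspose_trace]

theorem normSqVec_initialVec (ψ : (A × B) × R → ℂ) {K : ℕ} (hK : 0 < K) :
    normSqVec (initialVec ψ K) = normSqVec ψ := by
  have h := congrArg Matrix.trace (partialTraceFst_reduced_initialVec ψ hK)
  rw [trace_partialTraceFst, trace_partialTraceFst] at h
  rw [← asMatrix_mul_conjTranspose_trace, h, trace_partialTraceB]

theorem normSqVec_targetVec (ψ : (A × B) × R → ℂ) {L : ℕ} (hL : 0 < L) :
    normSqVec (targetVec ψ L) = normSqVec ψ := by
  have h := congrArg (fun M => (Matrix.trace M).re) (reduced_targetVec ψ hL)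
  simp only [Matrix.trace_smul, Matrix.trace_kronecker, Matrix.trace_one, trace_partialTraceFst,
    smul_eq_mul, Fintype.card_fin] at h
  rw [← Complex.ofReal_natCast, Complex.re_ofReal_mul, Complex.re_ofReal_mul,
    asMatrix_mul_conjTranspose_trace, trace_partialTraceB] at h
  exact mul_left_cancel₀ (by exact_mod_cast hL.ne') h

/-- Alice's half of `Φ_K` is `id/K`, so tensoring the operator inequality with it divides `lam` by
`K`; the `submatrix` only reorders the factors. -/
theorem posSemidef_smul_sub_reduced_initialVec [DecidableEq A] (ψ : (A × B) × R → ℂ) {K : ℕ}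
    {σ : Matrix R R ℂ} {lam : ℝ}
    (h : ((lam : ℂ) • ((1 : Matrix A A ℂ) ⊗ₖ σ) - partialTraceB (pureState ψ)).PosSemidef) :
    (((lam / K : ℝ) : ℂ) • ((1 : Matrix (A × Fin K) (A × Fin K) ℂ) ⊗ₖ σ) -
      asMatrix (initialVec ψ K) * (asMatrix (initialVec ψ K)).conjTranspose).PosSemidef := by
  classical
  have h1 := ((h.kronecker (Matrix.PosSemidef.one (n := Fin K) (R := ℂ))).submatrix
    (fun p : (A × Fin K) × R => ((p.1.1, p.2), p.1.2))).smul
      (show (0 : ℂ) ≤ ((1 / K : ℝ) : ℂ) by exact_mod_cast (by positivity : (0 : ℝ) ≤ 1 / K))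
  refine Eq.mp (congrArg _ (Eq.symm ?_)) h1
  ext p q
  rw [Matrix.sub_apply, reduced_initialVec_apply]
  simp only [Matrix.smul_apply, Matrix.submatrix_apply, Matrix.kroneckerMap_apply,
    Matrix.sub_apply, Matrix.one_apply, smul_eq_mul, Prod.ext_iff]
  by_cases h1 : p.1.2 = q.1.2 <;> by_cases h2 : p.1.1 = q.1.1 <;> simp [h1, h2]
  all_goals ring

end InitialState

/-! ### Merging by a random measurement, and the trivial protocol -/

section Protocol

variable {A B R : Type} [Fintype A] [Fintype B] [Fintype R]
    [DecidableEq A] [DecidableEq B] [DecidableEq R]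

/-- The weight `w` covers both uses: 1 for orthogonal projections that fill the space, `1/L` for
overlapping windows. -/
theorem isMeasurement_smul_mul_unitary {c n : Type} [Fintype c] [Fintype n] [DecidableEq n]
    {N : ℕ} {Q : Fin N → Matrix c n ℂ} {w : ℝ} (hw : 0 ≤ w)
    (hQ : (w : ℂ) • ∑ j, (Q j).conjTranspose * Q j = 1) (U : Matrix.unitaryGroup n ℂ) :
    IsMeasurement fun j => (√w : ℂ) • (Q j * (U : Matrix n n ℂ)) := by
  have hU : (U : Matrix n n ℂ).conjTranspose * (U : Matrix n n ℂ) = 1 :=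
    Matrix.mem_unitaryGroup_iff'.mp U.2
  have h : ∀ j, ((√w : ℂ) • (Q j * (U : Matrix n n ℂ))).conjTranspose *
      ((√w : ℂ) • (Q j * (U : Matrix n n ℂ))) = (U : Matrix n n ℂ).conjTranspose *
        ((w : ℂ) • ((Q j).conjTranspose * Q j)) * (U : Matrix n n ℂ) := by
    intro j
    rw [Matrix.conjTranspose_smul, Matrix.smul_mul, Matrix.mul_smul, smul_smul, Complex.star_def,
      Complex.conj_ofReal, ← Complex.ofReal_mul, Real.mul_self_sqrt hw, Matrix.conjTranspose_mul,
      Matrix.mul_smul, Matrix.smul_mul]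
    simp only [Matrix.mul_assoc]
  rw [IsMeasurement]
  simp only [h]
  rw [← Matrix.sum_mul, ← Matrix.mul_sum, ← Finset.smul_sum, hQ, Matrix.mul_one, hU]

theorem nonempty_of_normSqVec_eq_one {n : Type} [Fintype n] {v : n → ℂ} (h : normSqVec v = 1) :
    Nonempty n := by
  by_contra hn
  rw [not_nonempty_iff] at hn
  simp [normSqVec] at h

/-- State merging by a Haar random measurement of Alice. -/
theorem exists_merging_of_haar {ψ : (A × B) × R → ℂ} (hψ : normSqVec ψ = 1) {K L : ℕ} (hK : 0 < K)
    (hL : 0 < L) {σ : Matrix R R ℂ} (hσ : σ.PosDef) (hσ1 : σ.trace = 1) {lam : ℝ}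
    (hle : ((lam : ℂ) • ((1 : Matrix A A ℂ) ⊗ₖ σ) - partialTraceB (pureState ψ)).PosSemidef)
    {N : ℕ} {Q : Fin N → Matrix (Fin L) (A × Fin K) ℂ} {w : ℝ} (hw : 0 ≤ w)
    (hQ : ∀ j, Q j * (Q j).conjTranspose = 1)
    (hQ1 : (w : ℂ) • ∑ j, (Q j).conjTranspose * Q j = 1) :
    ∃ e : Matrix.unitaryGroup (A × Fin K) ℂ → ℝ, Continuous e ∧ (∀ U, 0 ≤ e U) ∧
      ∫ U, e U ∂(haarUnitary (A × Fin K)) ≤ √(L * (lam / K)) ∧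
      ∀ U : Matrix.unitaryGroup (A × Fin K) ℂ,
        ∃ D : Fin N → Fin (Fintype.card (B × Fin K) + 1) →
            Matrix (Fin L × A × B) (B × Fin K) ℂ, (∀ j, IsMeasurement (D j)) ∧
          IsStateMerging ψ K L (2 * √(e U)) (oneWay
            (fun j => (√w : ℂ) • (Q j * (U : Matrix (A × Fin K) (A × Fin K) ℂ))) D) := by
  obtain ⟨⟨⟨a₀, b₀⟩, -⟩⟩ := nonempty_of_normSqVec_eq_one hψ
  have : Nonempty (Fin L) := ⟨⟨0, hL⟩⟩
  have : Nonempty (Fin L × A × B) := ⟨(⟨0, hL⟩, a₀, b₀)⟩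
  have hn0 : (0 : ℝ) < Fintype.card (A × Fin K) := by
    have : Nonempty (A × Fin K) := ⟨(a₀, ⟨0, hK⟩)⟩
    exact_mod_cast Fintype.card_pos
  set φ := initialVec ψ K with hφ
  have hφ1 : normSqVec φ = 1 := by rw [hφ, normSqVec_initialVec ψ hK, hψ]
  set t := targetVec ψ L with ht
  have ht1 : normSqVec t = 1 := by rw [ht, normSqVec_targetVec ψ hL, hψ]
  set ρ := asMatrix φ * (asMatrix φ).conjTranspose with hρ
  have hρp : ρ.PosSemidef := Matrix.posSemidef_self_mul_conjTranspose _
  have hρ1 : ρ.trace.re = 1 := by rw [hρ, asMatrix_mul_conjTranspose_trace, hφ1]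
  choose e hec he0 hei heC using fun j =>
    decoupling hρp hρ1 hσ hσ1 (posSemidef_smul_sub_reduced_initialVec ψ hle) (hQ j)
  rw [Fintype.card_fin] at hei
  -- These are the outcome probabilities on a maximally mixed input; the trace of the completeness
  -- relation shows that they sum to one.
  have hcount : ∑ _j : Fin N, w * ((L : ℝ) / Fintype.card (A × Fin K)) = 1 := by
    have h := congrArg (fun M => (Matrix.trace M).re) hQ1
    have hj : ∀ j, ((Q j).conjTranspose * Q j).trace = L := fun j => by
      rw [Matrix.trace_mul_comm, hQ, Matrix.trace_one, Fintype.card_fin]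
    simp only [Matrix.trace_smul, Matrix.trace_sum, hj, Matrix.trace_one, smul_eq_mul, Complex.re_ofReal_mul, Complex.re_sum,
      Complex.natCast_re] at h
    rw [← Finset.mul_sum, ← Finset.sum_div, ← mul_div_assoc, h, div_self hn0.ne']
  refine ⟨fun U => ∑ j, w * e j U, continuous_finsetSum _ fun j _ => continuous_const.mul (hec j),
    fun U => Finset.sum_nonneg fun j _ => mul_nonneg hw (he0 j U), ?_, fun U => ?_⟩
  · rw [integral_finsetSum _ fun j _ =>
      (integrable_haarUnitary_of_continuous (hec j)).const_mul _]
    simp only [integral_const_mul]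
    calc ∑ j, w * ∫ U, e j U ∂(haarUnitary (A × Fin K))
        ≤ ∑ _j : Fin N, w * ((L : ℝ) / Fintype.card (A × Fin K) * √(L * (lam / K))) :=
          Finset.sum_le_sum fun j _ => mul_le_mul_of_nonneg_left (hei j) hw
      _ = √(L * (lam / K)) := by
          simp only [← mul_assoc w]
          rw [← Finset.sum_mul, hcount, one_mul]
  · have hP := isMeasurement_smul_mul_unitary hw hQ1 U
    obtain ⟨D, hD, hLO, hle⟩ := exists_oneWay_of_decoupled hP hφ1 ht1
      (fun _ => w * ((L : ℝ) / Fintype.card (A × Fin K))) (fun j => w * e j U) (fun _ => by positivity)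
      hcount (fun j C hC hC1 => by
        have hdev : branch ((√w : ℂ) • (Q j * (U : Matrix (A × Fin K) (A × Fin K) ℂ))) φ *
            (branch ((√w : ℂ) • (Q j * (U : Matrix (A × Fin K) (A × Fin K) ℂ))) φ).conjTranspose -
            ((w * ((L : ℝ) / Fintype.card (A × Fin K)) : ℝ) : ℂ) • (asMatrix t * (asMatrix t).conjTranspose) =
            (w : ℂ) • deviation ρ (Q j * (U : Matrix (A × Fin K) (A × Fin K) ℂ)) := by
          rw [branch_eq_mul, Matrix.smul_kronecker, Matrix.smul_mul, Matrix.conjTranspose_smul,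
            Matrix.smul_mul, Matrix.mul_smul, smul_smul, Complex.star_def, Complex.conj_ofReal,
            ← Complex.ofReal_mul, Real.mul_self_sqrt hw, Matrix.conjTranspose_mul, deviation,
            smul_sub, partialTraceFst_reduced_initialVec ψ hK, ← reduced_targetVec ψ hL, smul_smul,
            smul_smul]
          congr 1
          · rw [hρ]
            simp only [Matrix.mul_assoc]
          · congr 1
            push_cast
            ring
        rw [hdev, Matrix.mul_smul, Matrix.trace_smul, smul_eq_mul, Complex.re_ofReal_mul]
        exact mul_le_mul_of_nonneg_left (heC j U C hC hC1) hw)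
    exact ⟨D, hD, hLO, hle⟩

/-- Even the zero contractions, with no guaranteed fidelity, give the bound `2 √1 = 2`. -/
theorem exists_merging_trivial {ψ : (A × B) × R → ℂ} (hψ : normSqVec ψ = 1) {K L : ℕ} (hK : 0 < K)
    (hL : 0 < L) {N : ℕ} {P : Fin N → Matrix (Fin L) (A × Fin K) ℂ} (hP : IsMeasurement P)
    {δ : ℝ} (hδ : 2 ≤ δ) :
    ∃ D : Fin N → Fin (Fintype.card (B × Fin K) + 1) → Matrix (Fin L × A × B) (B × Fin K) ℂ,
      (∀ j, IsMeasurement (D j)) ∧ IsStateMerging ψ K L δ (oneWay P D) := by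
  obtain ⟨⟨⟨a₀, b₀⟩, -⟩⟩ := nonempty_of_normSqVec_eq_one hψ
  have : Nonempty (Fin L × A × B) := ⟨(⟨0, hL⟩, a₀, b₀)⟩
  obtain ⟨D, hD, hLO, hle⟩ := exists_oneWay_of_contractions hP
    (φ := initialVec ψ K) (by rw [normSqVec_initialVec ψ hK, hψ])
    (t := targetVec ψ L) (by rw [normSqVec_targetVec ψ hL, hψ]) (fun _ => 0)
    (fun _ => by simpa using Matrix.PosSemidef.one)
  refine ⟨D, hD, hLO, hle.trans (le_trans ?_ hδ)⟩
  have : √(1 - ∑ j, ‖star (targetVec ψ L) ⬝ᵥ applyBob (0 : Matrix (Fin L × A × B) (B × Fin K) ℂ)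
      (branch (P j) (initialVec ψ K))‖ ^ 2) ≤ 1 := by
    have h0 : 0 ≤ ∑ j, ‖star (targetVec ψ L) ⬝ᵥ applyBob (0 : Matrix (Fin L × A × B) (B × Fin K) ℂ)
      (branch (P j) (initialVec ψ K))‖ ^ 2 := Finset.sum_nonneg fun _ _ => by positivity
    exact Real.sqrt_le_one.mpr (by linarith)
  linarith

end Protocol

/-! ### Alice's measurements, and arithmetic of the cost -/

/-- Coordinate projections onto cyclic windows. -/
theorem exists_cyclic_windows {n : Type} [Fintype n] [DecidableEq n] [Nonempty n] {L : ℕ}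
    (hL : 0 < L) (hLn : L ≤ Fintype.card n) :
    ∃ Q : Fin (Fintype.card n) → Matrix (Fin L) n ℂ, (∀ j, Q j * (Q j).conjTranspose = 1) ∧
      ((1 / L : ℝ) : ℂ) • ∑ j, (Q j).conjTranspose * Q j = 1 := by
  have : NeZero (Fintype.card n) := ⟨Fintype.card_ne_zero⟩
  let f : n ≃ Fin (Fintype.card n) := Fintype.equivFin n
  let ι : Fin L ↪ Fin (Fintype.card n) := Fin.castLEEmb hLn
  have hLc : (L : ℂ) ≠ 0 := by exact_mod_cast hL.ne'
  -- Addition is modulo the dimension, so every basis vector lies in exactly `L` windows, whether or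
  -- not `L` divides the dimension. Hence the weight `1 / L`.
  refine ⟨fun j => Matrix.of fun l x => if f x = j + ι l then 1 else 0, fun j => ?_, ?_⟩
  · ext l l'
    rw [Matrix.mul_apply, ← f.symm.sum_comp]
    simp only [Matrix.conjTranspose_apply, Matrix.of_apply, Equiv.apply_symm_apply, Matrix.one_apply]
    by_cases h : l = l'
    · subst h
      simp
    · have : ι l' ≠ ι l := fun he => h (ι.injective he).symm
      simp [h, this]
  · ext x x'
    have hs : ∀ l : Fin L, ∑ j : Fin (Fintype.card n),
        (if f x = j + ι l then (1 : ℂ) else 0) * (if f x' = j + ι l then (1 : ℂ) else 0) =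
        if x = x' then 1 else 0 := by
      intro l
      rw [← (Equiv.subRight (ι l)).sum_comp]
      by_cases h : x = x'
      · subst h
        simp
      · simp [h]
    rw [Matrix.smul_apply, Matrix.sum_apply]
    simp only [Matrix.mul_apply, Matrix.conjTranspose_apply, Matrix.of_apply]
    rw [Finset.sum_comm]
    simp only [apply_ite star, star_one, star_zero, hs, Matrix.one_apply]
    by_cases h : x = x' <;> simp [h, hLc]

theorem exists_isometry_measurement {n : Type} [Fintype n] [DecidableEq n] {L : ℕ}
    (hLn : Fintype.card n ≤ L) : ∃ P : Fin 1 → Matrix (Fin L) n ℂ, IsMeasurement P := by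
  let ι : n ↪ Fin L := (Fintype.equivFin n).toEmbedding.trans (Fin.castLEEmb hLn)
  refine ⟨fun _ => Matrix.of fun l x => if l = ι x then 1 else 0, ?_⟩
  rw [IsMeasurement]
  ext x x'
  simp [Matrix.mul_apply, Matrix.one_apply, ι.injective.eq_iff, eq_comm]

/-- Stacking the `Q j` gives a matrix that is square up to relabelling, for which a right inverse is
also a left inverse. -/
theorem sum_conjTranspose_mul_self_of_orthogonal {n : Type} [Fintype n] [DecidableEq n] {N L : ℕ}
    (hNL : N * L = Fintype.card n) {Q : Fin N → Matrix (Fin L) n ℂ}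
    (hQ : ∀ j k, Q j * (Q k).conjTranspose = if j = k then 1 else 0) :
    ∑ j, (Q j).conjTranspose * Q j = 1 := by
  let f : Fin N × Fin L ≃ n := Fintype.equivOfCardEq (by simpa using hNL)
  let Z : Matrix (Fin N × Fin L) n ℂ := Matrix.of fun p x => Q p.1 p.2 x
  have h1 : Z * Z.conjTranspose = 1 := by
    ext p q
    have h := congrFun (congrFun (hQ p.1 q.1) p.2) q.2
    have e : (Z * Z.conjTranspose) p q = (Q p.1 * (Q q.1).conjTranspose) p.2 q.2 := rfl
    rw [e, h, Matrix.one_apply]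
    by_cases hpq : p.1 = q.1 <;> simp [hpq, Matrix.one_apply, Prod.ext_iff]
  have h2 : Z.conjTranspose * Z = 1 := (Matrix.mul_eq_one_comm_of_equiv f).mp h1
  rw [← h2]
  ext x y
  simp only [Matrix.sum_apply, Matrix.mul_apply, Fintype.sum_prod_type, Z,
    Matrix.conjTranspose_apply, Matrix.of_apply]

/-- Take the numerator and denominator of a rational number between `2 ^ target` and `2 ^ (target +
η)`. -/
theorem exists_nat_logb_sub_mem (target : ℝ) {η : ℝ} (hη : 0 < η) :
    ∃ K L : ℕ, 0 < K ∧ 0 < L ∧ target ≤ Real.logb 2 K - Real.logb 2 L ∧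
      Real.logb 2 K - Real.logb 2 L < target + η := by
  obtain ⟨q, hq1, hq2⟩ := exists_rat_btwn
    (Real.rpow_lt_rpow_of_exponent_lt (x := 2) (by norm_num) (lt_add_of_pos_right target hη))
  have hq0 : (0 : ℝ) < q := (Real.rpow_pos_of_pos (by norm_num) _).trans hq1
  have hq0' : 0 < q := by exact_mod_cast hq0
  have hnum : 0 < q.num := Rat.num_pos.mpr hq0'
  have hK : 0 < q.num.toNat := by omega
  have hquot : (q : ℝ) = (q.num.toNat : ℝ) / q.den := by
    have h1 : ((q.num.toNat : ℤ) : ℝ) = (q.num : ℝ) := by rw [Int.toNat_of_nonneg hnum.le]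
    rw [Rat.cast_def, ← h1, Int.cast_natCast]
  have hlog : Real.logb 2 q.num.toNat - Real.logb 2 q.den = Real.logb 2 q := by
    rw [hquot, Real.logb_div (by exact_mod_cast hK.ne') (by exact_mod_cast q.den_ne_zero)]
  refine ⟨q.num.toNat, q.den, hK, q.den_pos, ?_, ?_⟩
  · rw [hlog]
    exact ((Real.lt_logb_iff_rpow_lt (by norm_num) hq0).mpr hq1).le
  · rw [hlog]
    exact (Real.logb_lt_iff_lt_rpow (by norm_num) hq0).mpr hq2

theorem mul_div_le_of_cost {h ε lam : ℝ} (hε : 0 < ε) (hlam : lam ≤ 4 * (2 : ℝ) ^ (-h)) {K L : ℕ}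
    (hK : 0 < K) (hL : 0 < L)
    (hcost : -h + 2 * Real.logb 2 (1 / ε) ≤ Real.logb 2 K - Real.logb 2 L) :
    L * (lam / K) ≤ (2 * ε) ^ 2 := by
  have hK' : (0 : ℝ) < K := by exact_mod_cast hK
  have hL' : (0 : ℝ) < L := by exact_mod_cast hL
  have h1 : (2 : ℝ) ^ (-h) ≤ ε ^ 2 * (K / L) := by
    rw [← Real.le_logb_iff_rpow_le (by norm_num) (by positivity), Real.logb_mul (by positivity)
      (by positivity), Real.logb_div hK'.ne' hL'.ne', Real.logb_pow]
    rw [one_div, Real.logb_inv] at hcost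
    push_cast
    linarith
  calc L * (lam / K) ≤ L * (4 * (ε ^ 2 * (K / L)) / K) := by
        gcongr
        exact hlam.trans (by gcongr)
    _ = (2 * ε) ^ 2 := by
        field_simp
        norm_num

end StateMerging

/-! ### The theorem -/

theorem mainTheorem5 {A B R : Type} [Fintype A] [Fintype B] [Fintype R]
    [DecidableEq A] [DecidableEq B] [DecidableEq R]
    (ψ : (A × B) × R → ℂ) (hψ : ∑ x, ‖ψ x‖ ^ 2 = 1) (ε : ℝ) (hε : 0 < ε)
    (target : ℝ)
    (htarget : target =
      -StateMerging.condMinEntropy (StateMerging.partialTraceB (StateMerging.pureState ψ))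
        + 2 * Real.logb 2 (1 / ε)) :
    -- the cost `target` can be met from above up to an arbitrarily small excess
    (∀ η : ℝ, 0 < η → ∃ K L : ℕ, 0 < K ∧ 0 < L ∧
      target ≤ Real.logb 2 K - Real.logb 2 L ∧
      Real.logb 2 K - Real.logb 2 L < target + η) ∧
    (∀ K L : ℕ, 0 < K → 0 < L → target ≤ Real.logb 2 K - Real.logb 2 L →
      -- a measurement of Alice, followed by operations of Bob that depend on the outcome,
      -- is state merging with error `2√(2ε)`
      (∃ (N m : ℕ) (P : Fin N → Matrix (Fin L) (A × Fin K) ℂ)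
          (D : Fin N → Fin m → Matrix (Fin L × A × B) (B × Fin K) ℂ),
        StateMerging.IsMeasurement P ∧ (∀ j, StateMerging.IsMeasurement (D j)) ∧
        StateMerging.IsStateMerging ψ K L (2 * Real.sqrt (2 * ε)) (StateMerging.oneWay P D)) ∧
      -- if the dimension of `A ⊗ A₀` is `N * L`, then the measurement can be taken to be `Q j * U`
      -- with `U` Haar random and `Q j` any fixed projectors onto `N` orthogonal `L`-dimensional
      -- subspaces, each followed by a unitary from that subspace to `A₁`
      (∀ (N : ℕ), N * L = Fintype.card A * K →
        ∀ Q : Fin N → Matrix (Fin L) (A × Fin K) ℂ,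
        (∀ j k, Q j * (Q k).conjTranspose = if j = k then 1 else 0) →
        ∃ δ : Matrix.unitaryGroup (A × Fin K) ℂ → ℝ,
          MeasureTheory.Integrable δ (StateMerging.haarUnitary (A × Fin K)) ∧
          ∫ U, δ U ∂(StateMerging.haarUnitary (A × Fin K)) ≤ 2 * Real.sqrt (2 * ε) ∧
          ∀ U : Matrix.unitaryGroup (A × Fin K) ℂ,
            StateMerging.IsMeasurement (fun j => Q j * (U : Matrix (A × Fin K) (A × Fin K) ℂ)) ∧
            ∃ (m : ℕ) (D : Fin N → Fin m → Matrix (Fin L × A × B) (B × Fin K) ℂ),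
              (∀ j, StateMerging.IsMeasurement (D j)) ∧
              StateMerging.IsStateMerging ψ K L (δ U)
                (StateMerging.oneWay
                  (fun j => Q j * (U : Matrix (A × Fin K) (A × Fin K) ℂ)) D))) := by
  obtain rfl := htarget
  have hψ1 : StateMerging.normSqVec ψ = 1 := hψ
  refine ⟨fun η hη => StateMerging.exists_nat_logb_sub_mem _ hη, fun K L hK hL hcost => ?_⟩
  obtain ⟨⟨⟨a₀, -⟩, -⟩⟩ := StateMerging.nonempty_of_normSqVec_eq_one hψ1
  have hne : Nonempty (A × Fin K) := ⟨(a₀, ⟨0, hK⟩)⟩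
  have hρ1 : (StateMerging.partialTraceB (StateMerging.pureState ψ)).trace.re = 1 := by
    rw [StateMerging.trace_partialTraceB, hψ1]
  obtain ⟨σ, lam, hσ, hσ1, hle, hlam⟩ := StateMerging.exists_posDef_near_condMinEntropy
    (StateMerging.posSemidef_partialTraceB ψ) hρ1
  have hbound := StateMerging.mul_div_le_of_cost hε hlam hK hL hcost
  have hbound' : √(L * (lam / K)) ≤ 2 * ε := Real.sqrt_le_iff.mpr ⟨by positivity, hbound⟩
  refine ⟨?_, fun N hN Q hQ => ?_⟩
  · by_cases hLn : L ≤ Fintype.card (A × Fin K)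
    · obtain ⟨Q, hQ, hQ1⟩ := StateMerging.exists_cyclic_windows hL hLn
      obtain ⟨e, hec, -, hei, hmerge⟩ :=
        StateMerging.exists_merging_of_haar hψ1 hK hL hσ hσ1 hle (by positivity) hQ hQ1
      -- Some unitary does at least as well as the average.
      obtain ⟨U, hU⟩ := MeasureTheory.exists_le_integral
        (StateMerging.integrable_haarUnitary_of_continuous hec)
      obtain ⟨D, hD, hLO, hmer⟩ := hmerge U
      refine ⟨_, _, _, D, StateMerging.isMeasurement_smul_mul_unitary (by positivity) hQ1 U, hD,
        hLO, hmer.trans ?_⟩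
      gcongr
      exact hU.trans (hei.trans hbound')
    · obtain ⟨P, hP⟩ := StateMerging.exists_isometry_measurement (not_le.mp hLn).le
      -- Here `L` exceeds `|A| K`, while `lam |A| ≥ 1`; so `L lam / K ≥ 1`, and the cost bound
      -- leaves no room for a small `ε`.
      have hεlarge : 1 ≤ 2 * ε := by
        have h1 := StateMerging.one_le_mul_card hρ1 hσ1 hle
        have hK' : (0 : ℝ) < K := by exact_mod_cast hK
        have h2 : (Fintype.card A : ℝ) * K ≤ L := by
          have := (not_le.mp hLn).le
          rw [Fintype.card_prod, Fintype.card_fin] at this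
          exact_mod_cast this
        have hlam0 : 0 ≤ lam := by
          by_contra hneg
          have hA : 0 ≤ (Fintype.card A : ℝ) := by positivity
          nlinarith
        have h3 : 1 ≤ (2 * ε) ^ 2 := by
          refine le_trans ?_ hbound
          rw [← mul_div_assoc, le_div_iff₀ hK', one_mul]
          calc (K : ℝ) ≤ (lam * Fintype.card A) * K := le_mul_of_one_le_left hK'.le h1
            _ = Fintype.card A * K * lam := by ring
            _ ≤ L * lam := by gcongr
        nlinarith
      obtain ⟨D, hD, hmer⟩ := StateMerging.exists_merging_trivial hψ1 hK hL hP
        (δ := 2 * √(2 * ε)) (by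
          have : 1 ≤ √(2 * ε) := Real.one_le_sqrt.mpr hεlarge
          linarith)
      exact ⟨1, _, P, D, hP, hD, hmer⟩
  · have hQ1 : ((1 : ℝ) : ℂ) • ∑ j, (Q j).conjTranspose * Q j = 1 := by
      rw [Complex.ofReal_one, one_smul]
      exact StateMerging.sum_conjTranspose_mul_self_of_orthogonal
        (by rw [hN, Fintype.card_prod, Fintype.card_fin]) hQ
    obtain ⟨e, hec, he0, hei, hmerge⟩ := StateMerging.exists_merging_of_haar hψ1 hK hL hσ hσ1 hle
      zero_le_one (fun j => by simpa using hQ j j) hQ1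
    have hone : ∀ U : Matrix.unitaryGroup (A × Fin K) ℂ,
        (fun j => ((√(1 : ℝ) : ℝ) : ℂ) • (Q j * (U : Matrix (A × Fin K) (A × Fin K) ℂ))) =
          fun j => Q j * (U : Matrix (A × Fin K) (A × Fin K) ℂ) := by
      intro U
      simp
    have hint := StateMerging.integrable_haarUnitary_of_continuous hec.sqrt
    -- The error is a square root of the deviation for each `U`, so its mean is controlled by a
    -- second use of Jensen.
    refine ⟨fun U => 2 * √(e U), hint.const_mul 2, ?_, fun U => ⟨?_, ?_⟩⟩
    · rw [MeasureTheory.integral_const_mul]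
      gcongr
      refine (StateMerging.integral_sqrt_le
        (StateMerging.integrable_haarUnitary_of_continuous hec) hint he0).trans ?_
      exact Real.sqrt_le_sqrt (hei.trans hbound')
    · rw [← hone U]
      exact StateMerging.isMeasurement_smul_mul_unitary zero_le_one hQ1 U
    · obtain ⟨D, hD, hmer⟩ := hmerge U
      rw [hone U] at hmer
      exact ⟨_, D, hD, hmer⟩
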